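/- **Setting.** Let $0<k<n$, let $h$ be a positive definite hermitian $n\times n$ matrix, and let $\pi:\mathrm{Mat}(n,k;\mathbb C)^\times\to G^k(\mathbb C^n)=\mathrm{Mat}(n,k;\mathbb C)^\times/\mathrm{GL}(k,\mathbb C)$ be the projection from the $n\times k$ matrices $w=(w^i_\alpha)$ of rank $k$. With $\Delta=w^\dagger h w$, the $\mathrm{GL}(k,\mathbb C)$-invariant metric $$g^*=\sum h_{\bar\imath j}(\Delta^{-1})^{\beta\bar\alpha}\left(d\bar w^{\bar\imath}_{\bar\alpha}\otimes dw^j_\beta+dw^j_\beta\otimes d\bar w^{\bar\imath}_{\bar\alpha}\right)$$ induces a metric $g$ on $G^k(\mathbb C^n)$ by $g(X,Y)=g^*(X^*,Y^*)$, where $X^*$ denotes the horizontal lift ($g^*$-orthogonal to the fibres). Let $\nabla$ be the Levi-Civita connection of $g$, extended complex linearly, and also the induced connection on vector fields on a map into $G^k(\mathbb C^n)$. Let $M$ be a connected Riemann surface, $\psi:M\to G^k(\mathbb C^n)$ a holomorphic curve that is linearly full (no proper subspace of $\mathbb C^n$ contains all the subspaces $\psi(p)$), $U\subset M$ a coordinate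 neighbourhood with coordinate $z$, $\partial_-=\partial/\partial z$, $\partial_+=\partial/\partial\bar z$, and $\xi=\xi_0:U\to\mathrm{Mat}(n,k;\mathbb C)^\times$ a holomorphic lift of $\psi$. Let $k_0=k$ and let $\xi_a$ ($a=0,\dots,t$) be holomorphic $\mathrm{Mat}(n,k_a;\mathbb C)$-valued functions on $U$, $k_a\ge1$, such that the columns of $(\xi_0\cdots\xi_t)$ are linearly independent at every point and $\partial_-\xi_a=\sum_{b\le\min(a+1,t)}\xi_bB_{ba}$ with holomorphic matrix functions $B_{ba}$, where $B_{a+1,a}$ has generic rank $k_{a+1}$. Put inductively $\varphi_0=\xi_0$, $\beta_a=\varphi_a^\dagger h\varphi_a$, $\Pi_a=I_n-\varphi_a\beta_a^{-1}\varphi_a^\dagger h$, $\varphi_{a+1}=\Pi_a\cdots\Pi_0\,\xi_{a+1}$, and let $f_1,\dots,f_n$ be the columns of the Frenet frame $\varphi=(\varphi_0\cdots\varphi_t)$. **Theorem.** On $U$ one has $\partial_\pm f_i=\sum_j f_j(\lambda_\pm)^j_i$, where the coefficients $\lambda_\pm$ are those of the Frenet equations $$\partial_-\varphi_a=\varphi_a\beta_a^{-1}\partial_-\beta_a+\varphi_{a+1}B_{a+1,a},\qquad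 \partial_+\varphi_a=-\varphi_{a-1}\beta_{a-1}^{-1}B_{a,a-1}^\dagger\beta_a$$ (with $B_{t+1,t}=0$ and $\partial_+\varphi_0=0$). The vector fields on $\psi|_U$ $$E^\alpha_\mu=d\pi\circ\widetilde E^\alpha_\mu,\qquad \widetilde E^\alpha_\mu=\sum_j\varphi^j_\mu\Big(\frac{\partial}{\partial w^j_\alpha}\circ\xi\Big),\qquad 1\le\alpha\le k,\ k<\mu\le n,$$ form at each point of $U$ a basis of the tangent vectors of type $(1,0)$ to $G^k(\mathbb C^n)$, and the connection coefficients uniquely determined by $\nabla_{\partial_\pm}E^\alpha_\mu=\sum_{\nu=k+1}^n\sum_{\beta=1}^kE^\beta_\nu(\Lambda_\pm)^{\nu\alpha}_{\beta\mu}$ are $$(\Lambda_-)^{\nu\alpha}_{\beta\mu}=\delta^\alpha_\beta(\lambda_-)^\nu_\mu-(\beta_0^{-1}\partial_-\beta_0)^\alpha_\beta\,\delta^\nu_\mu,\qquad(\Lambda_+)^{\nu\alpha}_{\beta\mu}=\delta^\alpha_\beta(\lambda_+)^\nu_\mu.$$ -/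

import Mathlib

open scoped Matrix Manifold ContDiff ComplexOrder

namespace FrenetGrassmann

/-! ## The complex Grassmann manifold as an orbit space -/

section Grassmannian

/-- The set of complex `n × k` matrices of rank `k`. -/
abbrev FullRank (n k : ℕ) : Type := {w : Matrix (Fin n) (Fin k) ℂ // w.rank = k}

/-- `p ∼ p'` iff `p' = p g` for some `g ∈ GL(k, ℂ)`. -/
def orbitSetoid (n k : ℕ) : Setoid (FullRank n k) where
  r p p' := ∃ g : GL (Fin k) ℂ, p'.1 = p.1 * (g : Matrix (Fin k) (Fin k) ℂ)
  iseqv :=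
    { refl := fun p => ⟨1, by simp⟩
      symm := by
        rintro p p' ⟨g, hg⟩
        refine ⟨g⁻¹, ?_⟩
        rw [hg, Matrix.mul_assoc, ← Units.val_mul, mul_inv_cancel, Units.val_one, Matrix.mul_one]
      trans := by
        rintro p q r ⟨g, hg⟩ ⟨g', hg'⟩
        exact ⟨g * g', by rw [hg', hg, Units.val_mul, Matrix.mul_assoc]⟩ }

/-- The Grassmann manifold `G^k(ℂ^n)`, with the quotient topology. -/
def Gr (n k : ℕ) : Type := Quotient (orbitSetoid n k)

variable {n k : ℕ}

instance : TopologicalSpace (Gr n k) :=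
  inferInstanceAs (TopologicalSpace (Quotient (orbitSetoid n k)))

/-- The canonical projection `π`. -/
def Gr.proj (w : FullRank n k) : Gr n k := Quotient.mk (orbitSetoid n k) w

theorem Gr.isQuotientMap_proj : Topology.IsQuotientMap (Gr.proj (n := n) (k := k)) :=
  isQuotientMap_quotient_mk'

/-- The `k`-dimensional subspace of `ℂ^n` represented by a point of `G^k(ℂ^n)`. -/
def Gr.space : Gr n k → Submodule ℂ (Fin n → ℂ) :=
  Quotient.lift (s := orbitSetoid n k) (fun w => LinearMap.range w.1.mulVecLin) (by
    rintro p p' ⟨g, hg⟩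
    rw [hg, Matrix.mulVecLin_mul]
    refine (LinearMap.range_comp_of_range_eq_top _ ?_).symm
    rw [LinearMap.range_eq_top]
    intro v
    refine ⟨((g⁻¹ : GL (Fin k) ℂ) : Matrix (Fin k) (Fin k) ℂ) *ᵥ v, ?_⟩
    rw [Matrix.mulVecLin_apply, Matrix.mulVec_mulVec, ← Units.val_mul, mul_inv_cancel,
      Units.val_one, Matrix.one_mulVec])

/-- A splitting `ℂ^n = ℂ^k ⊕ ℂ^(n-k)`, that is, an invertible matrix `(P Q)` together with
its inverse (whose upper and lower blocks of rows are `A` and `C`). -/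
structure AffineChart (n k : ℕ) where
  A : Matrix (Fin k) (Fin n) ℂ
  C : Matrix (Fin (n - k)) (Fin n) ℂ
  P : Matrix (Fin n) (Fin k) ℂ
  Q : Matrix (Fin n) (Fin (n - k)) ℂ
  AP : A * P = 1
  AQ : A * Q = 0
  CP : C * P = 0
  CQ : C * Q = 1
  sum_eq : P * A + Q * C = 1

namespace AffineChart

variable (c : AffineChart n k)

/-- The matrix of affine coordinates of the subspace spanned by the columns of `w`. -/
noncomputable def coordFun (w : Matrix (Fin n) (Fin k) ℂ) : Matrix (Fin (n - k)) (Fin k) ℂ :=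
  c.C * w * (c.A * w)⁻¹

/-- The local section `Z ↦ (P Q) (1, Z)ᵀ = P + Q Z` of `π`. -/
def sect (Z : Matrix (Fin (n - k)) (Fin k) ℂ) : Matrix (Fin n) (Fin k) ℂ :=
  c.P + c.Q * Z

theorem A_mul_sect (Z : Matrix (Fin (n - k)) (Fin k) ℂ) : c.A * c.sect Z = 1 := by
  simp [sect, Matrix.mul_add, ← Matrix.mul_assoc, c.AP, c.AQ]

theorem C_mul_sect (Z : Matrix (Fin (n - k)) (Fin k) ℂ) : c.C * c.sect Z = Z := by
  simp [sect, Matrix.mul_add, ← Matrix.mul_assoc, c.CP, c.CQ]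

theorem coordFun_sect (Z : Matrix (Fin (n - k)) (Fin k) ℂ) : c.coordFun (c.sect Z) = Z := by
  simp [coordFun, A_mul_sect, C_mul_sect]

theorem sect_coordFun (w : Matrix (Fin n) (Fin k) ℂ) (hw : IsUnit (c.A * w)) :
    c.sect (c.coordFun w) = w * (c.A * w)⁻¹ := by
  have hd : IsUnit (c.A * w).det := (Matrix.isUnit_iff_isUnit_det _).1 hw
  have h1 : c.P = c.P * (c.A * w) * (c.A * w)⁻¹ := by
    rw [Matrix.mul_assoc, Matrix.mul_nonsing_inv _ hd, Matrix.mul_one]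
  calc c.sect (c.coordFun w)
      = c.P * (c.A * w) * (c.A * w)⁻¹ + c.Q * (c.C * w * (c.A * w)⁻¹) := by
        rw [← h1]; rfl
    _ = (c.P * c.A + c.Q * c.C) * w * (c.A * w)⁻¹ := by
        simp only [Matrix.add_mul, Matrix.mul_assoc]
    _ = w * (c.A * w)⁻¹ := by rw [c.sum_eq, Matrix.one_mul]

theorem rank_sect (Z : Matrix (Fin (n - k)) (Fin k) ℂ) : (c.sect Z).rank = k := by
  apply le_antisymm
  · simpa using (c.sect Z).rank_le_width
  · have h := Matrix.rank_mul_le_right c.A (c.sect Z)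
    rwa [A_mul_sect, Matrix.rank_one, Fintype.card_fin] at h

theorem coordFun_mul (w : Matrix (Fin n) (Fin k) ℂ) (g : GL (Fin k) ℂ) :
    c.coordFun (w * (g : Matrix (Fin k) (Fin k) ℂ)) = c.coordFun w := by
  have hg : IsUnit ((g : Matrix (Fin k) (Fin k) ℂ)).det :=
    (Matrix.isUnit_iff_isUnit_det _).1 g.isUnit
  unfold coordFun
  rw [← Matrix.mul_assoc c.A, ← Matrix.mul_assoc c.C, Matrix.mul_inv_rev, ← Matrix.mul_assoc,
    Matrix.mul_assoc (c.C * w), Matrix.mul_nonsing_inv _ hg, Matrix.mul_one]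

/-- The affine coordinates on `G^k(ℂ^n)` (only meaningful on `c.domain`). -/
noncomputable def coord : Gr n k → Matrix (Fin (n - k)) (Fin k) ℂ :=
  Quotient.lift (s := orbitSetoid n k) (fun w => c.coordFun w.1) (by
    rintro p p' ⟨g, hg⟩
    rw [hg, coordFun_mul])

/-- The domain of the affine coordinates. -/
def domain : Set (Gr n k) := {x | Quotient.lift (s := orbitSetoid n k)
  (fun w => IsUnit (c.A * w.1)) (by
    rintro p p' ⟨g, hg⟩
    rw [hg, ← Matrix.mul_assoc]
    exact propext ⟨fun h => h.mul g.isUnit, fun h => by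
      simpa [Matrix.mul_assoc, ← Units.val_mul] using h.mul (g⁻¹).isUnit⟩) x}

theorem proj_mem_domain (w : FullRank n k) : Gr.proj w ∈ c.domain ↔ IsUnit (c.A * w.1) := Iff.rfl

theorem coord_proj (w : FullRank n k) : c.coord (Gr.proj w) = c.coordFun w.1 := rfl

theorem continuousAt_inv {r : ℕ} {X : Type*} [TopologicalSpace X]
    {f : X → Matrix (Fin r) (Fin r) ℂ} {x : X} (hf : Continuous f) (hx : IsUnit (f x)) :
    ContinuousAt (fun y => (f y)⁻¹) x := by
  have hd : (f x).det ≠ 0 := ((Matrix.isUnit_iff_isUnit_det _).1 hx).ne_zero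
  simp only [Matrix.inv_def, Ring.inverse_eq_inv']
  exact (hf.matrix_det.continuousAt.inv₀ hd).smul hf.matrix_adjugate.continuousAt

theorem isOpen_domain : IsOpen c.domain := by
  rw [← Gr.isQuotientMap_proj.isOpen_preimage]
  have : Gr.proj ⁻¹' c.domain = {w : FullRank n k | (c.A * w.1).det ≠ 0} := by
    ext w
    rw [Set.mem_preimage, proj_mem_domain, Matrix.isUnit_iff_isUnit_det, isUnit_iff_ne_zero]
    rfl
  rw [this]
  exact isOpen_ne_fun (by fun_prop) continuous_const

theorem continuousOn_coord :
    ContinuousOn (fun (x : Gr n k) (i : Fin (n - k)) (j : Fin k) => c.coord x i j) c.domain := by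
  rw [Gr.isQuotientMap_proj.continuousOn_isOpen_iff c.isOpen_domain]
  intro w hw
  have hw : IsUnit (c.A * w.1) := hw
  apply ContinuousAt.continuousWithinAt
  have h1 : Continuous fun w : FullRank n k => c.C * w.1 := by fun_prop
  have h2 : ContinuousAt (fun w : FullRank n k => (c.A * w.1)⁻¹) w :=
    continuousAt_inv (by fun_prop) hw
  have h3 : ∀ (i : Fin (n - k)) (j : Fin k), ContinuousAt
      (fun w : FullRank n k => ∑ a, (c.C * w.1) i a * (c.A * w.1)⁻¹ a j) w := by
    intro i j
    refine tendsto_finsetSum _ fun a _ => ?_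
    refine ContinuousAt.mul (h1.matrix_elem i a).continuousAt ?_
    exact ((continuous_id.matrix_elem a j).tendsto _).comp h2
  refine continuousAt_pi.2 fun i => continuousAt_pi.2 fun j => ?_
  have h4 : (fun w : FullRank n k => c.coord (Gr.proj w) i j)
      = fun w : FullRank n k => ∑ a, (c.C * w.1) i a * (c.A * w.1)⁻¹ a j := by
    funext w
    rw [coord_proj, coordFun, Matrix.mul_apply]
  have h5 : ContinuousAt (fun w : FullRank n k => c.coord (Gr.proj w) i j) w := h4 ▸ h3 i j
  exact h5

/-- The affine chart of `G^k(ℂ^n)`, with values in `(n-k) × k` matrices, seen as a normed space. -/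
noncomputable def toChart : OpenPartialHomeomorph (Gr n k) (Fin (n - k) → Fin k → ℂ) where
  toFun x := fun i j => c.coord x i j
  invFun Z := Gr.proj ⟨c.sect (Matrix.of Z), c.rank_sect _⟩
  source := c.domain
  target := Set.univ
  map_source' _ _ := Set.mem_univ _
  map_target' Z _ := by
    rw [proj_mem_domain, A_mul_sect]
    exact isUnit_one
  left_inv' x hx := by
    obtain ⟨w, rfl⟩ := Gr.isQuotientMap_proj.surjective x
    have hw : IsUnit (c.A * w.1) := hx
    symm
    refine Quotient.sound (s := orbitSetoid n k) ⟨hw.unit⁻¹, ?_⟩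
    have := c.sect_coordFun w.1 hw
    rw [Matrix.coe_units_inv, IsUnit.unit_spec]
    exact this
  right_inv' Z _ := c.coordFun_sect (Matrix.of Z)
  open_source := c.isOpen_domain
  open_target := isOpen_univ
  continuousOn_toFun := c.continuousOn_coord
  continuousOn_invFun := by
    apply Continuous.continuousOn
    refine Gr.isQuotientMap_proj.continuous.comp (Continuous.subtype_mk ?_ _)
    have : Continuous fun Z : Fin (n - k) → Fin k → ℂ =>
        (Matrix.of Z : Matrix (Fin (n - k)) (Fin k) ℂ) := continuous_id
    exact continuous_const.add (Continuous.matrix_mul continuous_const this)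

/-- Every point of `G^k(ℂ^n)` lies in the domain of an affine chart. -/
theorem exists_mem_domain (x : Gr n k) : ∃ c : AffineChart n k, x ∈ c.domain := by
  obtain ⟨w, rfl⟩ := Gr.isQuotientMap_proj.surjective x
  have hinj : LinearMap.ker w.1.mulVecLin = ⊥ := by
    rw [← Submodule.finrank_eq_zero (R := ℂ)]
    have h1 := LinearMap.finrank_range_add_finrank_ker w.1.mulVecLin
    have h2 : Module.finrank ℂ (LinearMap.range w.1.mulVecLin) = k := w.2
    rw [h2, Module.finrank_fin_fun] at h1
    omega
  obtain ⟨L, hL⟩ := LinearMap.exists_leftInverse_of_injective w.1.mulVecLin hinj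
  have hLs : LinearMap.range L = ⊤ := by
    rw [LinearMap.range_eq_top]
    intro v
    exact ⟨_, LinearMap.congr_fun hL v⟩
  have hker : Module.finrank ℂ (LinearMap.ker L) = n - k := by
    have h1 := LinearMap.finrank_range_add_finrank_ker L
    rw [hLs, finrank_top, Module.finrank_fin_fun, Module.finrank_fin_fun] at h1
    omega
  let e : (Fin (n - k) → ℂ) ≃ₗ[ℂ] LinearMap.ker L :=
    LinearEquiv.ofFinrankEq _ _ (by rw [hker, Module.finrank_fin_fun])
  let W := w.1.mulVecLin
  have hLW : ∀ v, L (W v) = v := fun v => LinearMap.congr_fun hL v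
  let q : (Fin (n - k) → ℂ) →ₗ[ℂ] (Fin n → ℂ) := (LinearMap.ker L).subtype ∘ₗ e.toLinearMap
  let d : (Fin n → ℂ) →ₗ[ℂ] (Fin (n - k) → ℂ) := e.symm.toLinearMap ∘ₗ
    LinearMap.codRestrict (LinearMap.ker L) (LinearMap.id - W ∘ₗ L) (fun v => by
      simp [hLW])
  have hLq : L ∘ₗ q = 0 := by
    ext1 i
    exact LinearMap.ext fun v => (e _).2
  have hdW : d ∘ₗ W = 0 := by
    refine LinearMap.ext fun v => ?_
    have : LinearMap.codRestrict (LinearMap.ker L) (LinearMap.id - W ∘ₗ L)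
        (fun v => by simp [hLW]) (W v) = 0 := by
      apply Subtype.ext
      simp [hLW]
    simp only [d, LinearMap.comp_apply, LinearMap.zero_apply]
    rw [this, map_zero]
  have hdq : d ∘ₗ q = LinearMap.id := by
    refine LinearMap.ext fun v => ?_
    have : LinearMap.codRestrict (LinearMap.ker L) (LinearMap.id - W ∘ₗ L)
        (fun v => by simp [hLW]) (q v) = e v := by
      apply Subtype.ext
      have h0 : L (q v) = 0 := LinearMap.congr_fun hLq v
      simp only [LinearMap.codRestrict_apply, LinearMap.sub_apply, LinearMap.id_apply,
        LinearMap.comp_apply, h0, map_zero, sub_zero]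
      rfl
    simp only [d, LinearMap.comp_apply, LinearMap.id_apply]
    rw [this]
    exact e.symm_apply_apply v
  have hsum : W ∘ₗ L + q ∘ₗ d = LinearMap.id := by
    refine LinearMap.ext fun v => ?_
    simp only [d, q, LinearMap.add_apply, LinearMap.comp_apply, LinearMap.id_apply]
    have : e.toLinearMap (e.symm.toLinearMap (LinearMap.codRestrict (LinearMap.ker L)
        (LinearMap.id - W ∘ₗ L) (fun v => by simp [hLW]) v)) = _ := e.apply_symm_apply _
    rw [this]
    simp
  have hWm : LinearMap.toMatrix' W = w.1 := LinearMap.toMatrix'_toLin' w.1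
  have hLW' : LinearMap.toMatrix' L * w.1 = 1 := by
    rw [← hWm, ← LinearMap.toMatrix'_comp]
    exact (congrArg LinearMap.toMatrix' hL).trans LinearMap.toMatrix'_id
  refine ⟨⟨LinearMap.toMatrix' L, LinearMap.toMatrix' d, w.1, LinearMap.toMatrix' q, hLW',
    ?_, ?_, ?_, ?_⟩, ?_⟩
  · rw [← LinearMap.toMatrix'_comp, hLq, map_zero]
  · rw [← hWm, ← LinearMap.toMatrix'_comp, hdW, map_zero]
  · rw [← LinearMap.toMatrix'_comp, hdq, LinearMap.toMatrix'_id]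
  · rw [← hWm, ← LinearMap.toMatrix'_comp, ← LinearMap.toMatrix'_comp, ← map_add, hsum,
      LinearMap.toMatrix'_id]
  · rw [proj_mem_domain]
    exact hLW' ▸ isUnit_one

end AffineChart

noncomputable instance : ChartedSpace (Fin (n - k) → Fin k → ℂ) (Gr n k) where
  atlas := Set.range AffineChart.toChart
  chartAt x := (AffineChart.exists_mem_domain x).choose.toChart
  mem_chart_source x := (AffineChart.exists_mem_domain x).choose_spec
  chart_mem_atlas _ := Set.mem_range_self _

theorem contDiff_det {r : ℕ} {E : Type*} [NormedAddCommGroup E] [NormedSpace ℂ E]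
    {f : E → Matrix (Fin r) (Fin r) ℂ} (hf : ∀ i j, ContDiff ℂ ω fun x => f x i j) :
    ContDiff ℂ ω fun x => (f x).det := by
  simp only [Matrix.det_apply]
  refine ContDiff.sum fun σ _ => ContDiff.const_smul _ ?_
  exact contDiff_prod fun i _ => hf _ _

theorem contDiff_adjugate {r : ℕ} {E : Type*} [NormedAddCommGroup E] [NormedSpace ℂ E]
    {f : E → Matrix (Fin r) (Fin r) ℂ} (hf : ∀ i j, ContDiff ℂ ω fun x => f x i j) (i j : Fin r) :
    ContDiff ℂ ω fun x => (f x).adjugate i j := by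
  simp only [Matrix.adjugate_apply]
  refine contDiff_det fun a b => ?_
  by_cases h : a = j
  · subst h
    simpa using contDiff_const
  · simpa [Matrix.updateRow_ne h] using hf a b

/-- The affine charts form a complex analytic atlas. -/
instance : IsManifold 𝓘(ℂ, Fin (n - k) → Fin k → ℂ) ω (Gr n k) := by
  apply isManifold_of_contDiffOn
  rintro _ _ ⟨c, rfl⟩ ⟨c', rfl⟩
  intro Z hZ
  apply ContDiffAt.contDiffWithinAt
  have hs : ∀ i j, ContDiff ℂ ω fun Z : Fin (n - k) → Fin k → ℂ => c.sect (Matrix.of Z) i j := by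
    intro i j
    simp only [AffineChart.sect, Matrix.add_apply, Matrix.mul_apply, Matrix.of_apply]
    fun_prop
  have hA : ∀ i j, ContDiff ℂ ω fun Z : Fin (n - k) → Fin k → ℂ =>
      (c'.A * c.sect (Matrix.of Z)) i j := by
    intro i j
    simp only [Matrix.mul_apply]
    exact ContDiff.sum fun a _ => contDiff_const.mul (hs _ _)
  have hC : ∀ i j, ContDiff ℂ ω fun Z : Fin (n - k) → Fin k → ℂ =>
      (c'.C * c.sect (Matrix.of Z)) i j := by
    intro i j
    simp only [Matrix.mul_apply]
    exact ContDiff.sum fun a _ => contDiff_const.mul (hs _ _)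
  have hd : (c'.A * c.sect (Matrix.of Z)).det ≠ 0 := by
    have h1 : (AffineChart.toChart c).symm Z ∈ c'.domain := by
      have := hZ.1.2
      exact this
    have h2 : IsUnit (c'.A * c.sect (Matrix.of Z)) := h1
    exact ((Matrix.isUnit_iff_isUnit_det _).1 h2).ne_zero
  have key : ContDiffAt ℂ ω (fun Z : Fin (n - k) → Fin k → ℂ =>
      fun i j => (c'.coordFun (c.sect (Matrix.of Z))) i j) Z := by
    refine contDiffAt_pi.2 fun i => contDiffAt_pi.2 fun j => ?_
    simp only [AffineChart.coordFun]
    have : (fun Z : Fin (n - k) → Fin k → ℂ => (c'.C * c.sect (Matrix.of Z) *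
        (c'.A * c.sect (Matrix.of Z))⁻¹) i j) = fun Z => ∑ a,
        (c'.C * c.sect (Matrix.of Z)) i a * (((c'.A * c.sect (Matrix.of Z)).det)⁻¹ *
          (c'.A * c.sect (Matrix.of Z)).adjugate a j) := by
      funext Z
      rw [Matrix.mul_apply]
      simp [Matrix.inv_def, Ring.inverse_eq_inv']
    rw [this]
    refine ContDiffAt.sum fun a _ => (hC _ _).contDiffAt.mul (ContDiffAt.mul ?_ ?_)
    · exact (contDiff_det hA).contDiffAt.inv hd
    · exact (contDiff_adjugate hA _ _).contDiffAt
  exact key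

end Grassmannian

/-! ## Wirtinger derivatives and complexified tangent vectors -/

section Wirtinger

/-- Index set of a complex coordinate frame of the complexified tangent bundle of an open set of
`r × s` matrices `w`: `Sum.inl (i, α)` stands for `∂/∂w^i_α` and `Sum.inr (i, α)` for
`∂/∂w̄^i_α`. Complexified tangent vectors are written as their component vectors
`CIdx r s → ℂ`. -/
abbrev CIdx (r s : ℕ) : Type := (Fin r × Fin s) ⊕ (Fin r × Fin s)

variable {V : Type*} [AddCommGroup V] [Module ℂ V]

/-- `(∂_x - i ∂_y) f / 2` at `w`, along the complex line `w + (x + i y) v`. -/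
noncomputable def dHol (f : V → ℂ) (w v : V) : ℂ :=
  (deriv (fun s : ℝ => f (w + (s : ℂ) • v)) 0
    - Complex.I * deriv (fun s : ℝ => f (w + ((s : ℂ) * Complex.I) • v)) 0) / 2

/-- `(∂_x + i ∂_y) f / 2` at `w`, along the complex line `w + (x + i y) v`. -/
noncomputable def dBar (f : V → ℂ) (w v : V) : ℂ :=
  (deriv (fun s : ℝ => f (w + (s : ℂ) • v)) 0
    + Complex.I * deriv (fun s : ℝ => f (w + ((s : ℂ) * Complex.I) • v)) 0) / 2

variable {r s r' s' : ℕ}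

/-- The derivative of a function of a matrix argument along a complex coordinate vector field. -/
noncomputable def coordDeriv (f : Matrix (Fin r) (Fin s) ℂ → ℂ) (w : Matrix (Fin r) (Fin s) ℂ) :
    CIdx r s → ℂ
  | Sum.inl q => dHol f w (Matrix.single q.1 q.2 1)
  | Sum.inr q => dBar f w (Matrix.single q.1 q.2 1)

/-- The complex coordinates and their conjugates, as functions of a matrix. -/
def coordFn (Z : Matrix (Fin r) (Fin s) ℂ) : CIdx r s → ℂ
  | Sum.inl q => Z q.1 q.2
  | Sum.inr q => star (Z q.1 q.2)

/-- The (complexified) differential of a mapping between open sets of matrices. -/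
noncomputable def push (F : Matrix (Fin r) (Fin s) ℂ → Matrix (Fin r') (Fin s') ℂ)
    (w : Matrix (Fin r) (Fin s) ℂ) (X : CIdx r s → ℂ) : CIdx r' s' → ℂ :=
  fun A => ∑ D, X D * coordDeriv (fun w' => coordFn (F w') A) w D

/-- The matrix of the components of `X` of type `(1, 0)`. -/
def hol (X : CIdx r s → ℂ) : Matrix (Fin r) (Fin s) ℂ := Matrix.of fun i j => X (Sum.inl (i, j))

/-- The matrix of the components of `X` of type `(0, 1)`. -/
def bar (X : CIdx r s → ℂ) : Matrix (Fin r) (Fin s) ℂ := Matrix.of fun i j => X (Sum.inr (i, j))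

/-- The space of vectors of type `(1, 0)`. -/
def holVectors (r s : ℕ) : Submodule ℂ (CIdx r s → ℂ) where
  carrier := {X | ∀ q, X (Sum.inr q) = 0}
  add_mem' {X Y} hX hY q := by
    have h1 : X (Sum.inr q) = 0 := hX q
    have h2 : Y (Sum.inr q) = 0 := hY q
    simp [h1, h2]
  zero_mem' _ := rfl
  smul_mem' a X hX q := by
    have h1 : X (Sum.inr q) = 0 := hX q
    simp [h1]

end Wirtinger

/-! ## The metrics and the Levi-Civita connection -/

section Metric

variable {n k : ℕ} (h : Matrix (Fin n) (Fin n) ℂ)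

/-- `I - w (w† h w)⁻¹ w† h`, the `h`-orthogonal projection onto the orthogonal complement of the
span of the columns of `w`. -/
noncomputable def orthProj {r : ℕ} (w : Matrix (Fin n) (Fin r) ℂ) : Matrix (Fin n) (Fin n) ℂ :=
  1 - w * (wᴴ * h * w)⁻¹ * wᴴ * h

/-- The `GL(k, ℂ)`-invariant metric `g*` on the `n × k` matrices of rank `k` at `w`, extended
complex bilinearly: with `Δ = w† h w`,
`g* = ∑ h_{ij} (Δ⁻¹)^{βα} (dw̄^i_α ⊗ dw^j_β + dw^j_β ⊗ dw̄^i_α)`. -/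
noncomputable def gStar (w : Matrix (Fin n) (Fin k) ℂ) (X Y : CIdx n k → ℂ) : ℂ :=
  ∑ i, ∑ j, ∑ α, ∑ β, h i j * (wᴴ * h * w)⁻¹ β α *
    (X (Sum.inr (i, α)) * Y (Sum.inl (j, β)) + X (Sum.inl (j, β)) * Y (Sum.inr (i, α)))

/-- The vertical vectors at `w`, spanned by the Killing fields `∑ w^i_α ∂/∂w^i_β` and their
conjugates. -/
def IsVertical (w : Matrix (Fin n) (Fin k) ℂ) (X : CIdx n k → ℂ) : Prop :=
  ∃ a b : Matrix (Fin k) (Fin k) ℂ, hol X = w * a ∧ bar X = w.map star * b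

/-- The horizontal component of a tangent vector at `w`, that is, its component `g*`-orthogonal to
the vertical vectors (see `isVertical_sub_perp` and `gStar_perp`). -/
noncomputable def perp (w : Matrix (Fin n) (Fin k) ℂ) (X : CIdx n k → ℂ) : CIdx n k → ℂ
  | Sum.inl q => (orthProj h w * hol X) q.1 q.2
  | Sum.inr q => ((orthProj h w).map star * bar X) q.1 q.2

theorem isVertical_sub_perp (w : Matrix (Fin n) (Fin k) ℂ) (X : CIdx n k → ℂ) :
    IsVertical w (X - perp h w X) := by
  have e1 : hol (X - perp h w X) = hol X - orthProj h w * hol X := rfl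
  have e2 : bar (X - perp h w X) = bar X - (orthProj h w).map star * bar X := rfl
  refine ⟨(wᴴ * h * w)⁻¹ * wᴴ * h * hol X, ((wᴴ * h * w)⁻¹ * wᴴ * h).map star * bar X, ?_, ?_⟩
  · rw [e1, orthProj, Matrix.sub_mul, Matrix.one_mul, sub_sub_cancel]
    simp only [Matrix.mul_assoc]
  · have e3 : (orthProj h w).map star
        = 1 - w.map star * ((wᴴ * h * w)⁻¹ * wᴴ * h).map star := by
      have := Matrix.map_mul (L := w) (M := (wᴴ * h * w)⁻¹ * wᴴ * h) (f := starRingEnd ℂ)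
      rw [orthProj, Matrix.map_sub star (star_sub), Matrix.map_one _ (star_zero _) (star_one _)]
      congr 1
      rw [Matrix.mul_assoc, Matrix.mul_assoc, ← Matrix.mul_assoc (wᴴ * h * w)⁻¹]
      exact this
    rw [e2, e3, Matrix.sub_mul, Matrix.one_mul, sub_sub_cancel, Matrix.mul_assoc]

theorem gStar_eq_trace (w : Matrix (Fin n) (Fin k) ℂ) (X Y : CIdx n k → ℂ) :
    gStar h w X Y = ((bar X)ᵀ * h * hol Y * (wᴴ * h * w)⁻¹).trace
      + ((bar Y)ᵀ * h * hol X * (wᴴ * h * w)⁻¹).trace := by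
  have key : ∀ U V : Matrix (Fin n) (Fin k) ℂ, ∀ D : Matrix (Fin k) (Fin k) ℂ,
      (Uᵀ * h * V * D).trace = ∑ i, ∑ j, ∑ α, ∑ β, h i j * D β α * (U i α * V j β) := by
    intro U V D
    simp only [Matrix.trace, Matrix.diag_apply, Matrix.mul_apply, Matrix.transpose_apply,
      Finset.sum_mul]
    calc _ = ∑ α, ∑ β, ∑ i, ∑ j, U i α * h i j * V j β * D β α := by
          refine Finset.sum_congr rfl fun α _ => Finset.sum_congr rfl fun β _ => ?_
          rw [Finset.sum_comm]
      _ = ∑ α, ∑ i, ∑ j, ∑ β, U i α * h i j * V j β * D β α := by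
          refine Finset.sum_congr rfl fun α _ => ?_
          rw [Finset.sum_comm]
          exact Finset.sum_congr rfl fun i _ => Finset.sum_comm
      _ = ∑ i, ∑ j, ∑ α, ∑ β, U i α * h i j * V j β * D β α := by
          rw [Finset.sum_comm]
          exact Finset.sum_congr rfl fun i _ => Finset.sum_comm
      _ = _ := by
          refine Finset.sum_congr rfl fun i _ => Finset.sum_congr rfl fun j _ =>
            Finset.sum_congr rfl fun α _ => Finset.sum_congr rfl fun β _ => by ring
  rw [key, key]
  simp only [← Finset.sum_add_distrib, ← mul_add]
  refine Finset.sum_congr rfl fun i _ => Finset.sum_congr rfl fun j _ =>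
    Finset.sum_congr rfl fun α _ => Finset.sum_congr rfl fun β _ => ?_
  simp only [hol, bar, Matrix.of_apply]
  ring

theorem gStar_perp (hh : h.IsHermitian) (w : Matrix (Fin n) (Fin k) ℂ)
    (hw : IsUnit (wᴴ * h * w).det) (X Y : CIdx n k → ℂ) (hY : IsVertical w Y) :
    gStar h w (perp h w X) Y = 0 := by
  obtain ⟨a, b, ha, hb⟩ := hY
  have e1 : hol (perp h w X) = orthProj h w * hol X := rfl
  have e2 : bar (perp h w X) = (orthProj h w).map star * bar X := rfl
  have hD : (wᴴ * h * w)ᴴ = wᴴ * h * w := by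
    simp [Matrix.conjTranspose_mul, hh.eq, Matrix.mul_assoc]
  have h1 : wᴴ * h * orthProj h w = 0 := by
    rw [orthProj, Matrix.mul_sub, Matrix.mul_one, sub_eq_zero]
    simp only [← Matrix.mul_assoc]
    rw [Matrix.mul_nonsing_inv _ hw, Matrix.one_mul]
  have h2 : (orthProj h w)ᴴ * h * w = 0 := by
    have := congrArg Matrix.conjTranspose h1
    simpa [Matrix.conjTranspose_mul, hh.eq, Matrix.mul_assoc] using this
  have h3 : ((orthProj h w).map star)ᵀ = (orthProj h w)ᴴ := rfl
  have h4 : (w.map star)ᵀ = wᴴ := rfl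
  rw [gStar_eq_trace, ha, hb, e1, e2, Matrix.transpose_mul, Matrix.transpose_mul, h3, h4]
  have t1 : (bar X)ᵀ * (orthProj h w)ᴴ * h * (w * a) = 0 := by
    rw [show (bar X)ᵀ * (orthProj h w)ᴴ * h * (w * a)
      = (bar X)ᵀ * ((orthProj h w)ᴴ * h * w) * a by simp only [Matrix.mul_assoc], h2]
    simp
  have t2 : bᵀ * wᴴ * h * (orthProj h w * hol X) = 0 := by
    rw [show bᵀ * wᴴ * h * (orthProj h w * hol X)
      = bᵀ * (wᴴ * h * orthProj h w) * hol X by simp only [Matrix.mul_assoc], h1]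
    simp
  rw [t1, t2]
  simp

/-- The components, in an affine chart, of the metric `g` on `G^k(ℂ^n)` defined by
`g(X, Y) = g*(X*, Y*)`. The horizontal lift of a tangent vector to a point of the fibre is the
horizontal component of any lift of the vector to that point; here the lift along the local
section is used. -/
noncomputable def metricMatrix (c : AffineChart n k) (Z : Matrix (Fin (n - k)) (Fin k) ℂ) :
    Matrix (CIdx (n - k) k) (CIdx (n - k) k) ℂ :=
  Matrix.of fun A D => gStar h (c.sect Z)
    (perp h (c.sect Z) (push c.sect Z (Pi.single A 1)))
    (perp h (c.sect Z) (push c.sect Z (Pi.single D 1)))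

/-- The Christoffel symbols `Γ^A_{BD}` of the Levi-Civita connection of `g` in the complex
coordinate frame of an affine chart. -/
noncomputable def christoffel (c : AffineChart n k) (Z : Matrix (Fin (n - k)) (Fin k) ℂ)
    (A B D : CIdx (n - k) k) : ℂ :=
  (1 / 2) * ∑ F, (metricMatrix h c Z)⁻¹ A F *
    (coordDeriv (fun Z' => metricMatrix h c Z' F D) Z B
      + coordDeriv (fun Z' => metricMatrix h c Z' F B) Z D
      - coordDeriv (fun Z' => metricMatrix h c Z' B D) Z F)

/-- The covariant derivative, in an affine chart, of a (complexified) vector field `X` on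
`ψ : M → G^k(ℂ^n)` along the complexified tangent vector of `M` acting on functions as `∂`:
`(∇_∂ X)^A = ∂ X^A + ∑ Γ^A_{BD}(ψ) (dψ ∂)^B X^D`. It depends only on the values of `X` near the
point in question. -/
noncomputable def covDeriv {M : Type*} (c : AffineChart n k) (ψ : M → Gr n k)
    (dd : (M → ℂ) → M → ℂ) (X : M → CIdx (n - k) k → ℂ) (p : M) : CIdx (n - k) k → ℂ :=
  fun A => dd (fun q => X q A) p + ∑ B, ∑ D, christoffel h c (c.coord (ψ p)) A B D *
    dd (fun q => coordFn (c.coord (ψ q)) B) p * X p D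

end Metric

/-! ## Holomorphic curves and Frenet frames -/

section Frenet

variable {M : Type*} [TopologicalSpace M]

/-- `∂_- = ∂/∂z` in the local coordinate `z`. -/
noncomputable def dMinus (z : OpenPartialHomeomorph M ℂ) (F : M → ℂ) (p : M) : ℂ :=
  dHol (F ∘ z.symm) (z p) 1

/-- `∂_+ = ∂/∂z̄` in the local coordinate `z`. -/
noncomputable def dPlus (z : OpenPartialHomeomorph M ℂ) (F : M → ℂ) (p : M) : ℂ :=
  dBar (F ∘ z.symm) (z p) 1

/-- Entrywise application of a derivation to a matrix-valued function. -/
def mapMat {R S : Type*} (dd : (M → ℂ) → M → ℂ) (F : M → Matrix R S ℂ) (p : M) : Matrix R S ℂ :=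
  Matrix.of fun i j => dd (fun q => F q i j) p

/-- A matrix-valued function is holomorphic on the coordinate neighbourhood of `z`. -/
def HolomorphicOn {R S : Type*} (z : OpenPartialHomeomorph M ℂ) (F : M → Matrix R S ℂ) : Prop :=
  ∀ i j, DifferentiableOn ℂ ((fun q => F q i j) ∘ z.symm) z.target

/-- `ψ` is linearly full: no proper subspace of `ℂ^n` contains all the subspaces `ψ(p)`. -/
def LinearlyFull {n k : ℕ} (ψ : M → Gr n k) : Prop :=
  ∀ W : Submodule ℂ (Fin n → ℂ), (∀ p, (ψ p).space ≤ W) → W = ⊤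

/-- `ξ` is a holomorphic lift of `ψ` on the coordinate neighbourhood of `z`. -/
def IsHolomorphicLift {n k : ℕ} (z : OpenPartialHomeomorph M ℂ) (ψ : M → Gr n k)
    (ξ : M → Matrix (Fin n) (Fin k) ℂ) : Prop :=
  HolomorphicOn z ξ ∧ ∀ p ∈ z.source, ∃ hr : (ξ p).rank = k, Gr.proj ⟨ξ p, hr⟩ = ψ p

variable {n t : ℕ} {κ : Fin (t + 1) → ℕ}

/-- Index set of the columns of a block matrix with column blocks of sizes `κ 0, …, κ t`. -/
abbrev BlockIdx (κ : Fin (t + 1) → ℕ) : Type := (a : Fin (t + 1)) × Fin (κ a)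

/-- Holomorphic functions `ξ_0, …, ξ_t` (with `ξ_a` of size `n × κ a`) obtained by the successive
choices `∂_- ξ_a = ∑_{b ≤ a+1} ξ_b B_{ba}`: the matrix `(ξ_0 ⋯ ξ_t)` has linearly independent
columns everywhere and `(ξ_0 ⋯ ξ_a ∂_- ξ_a)` has rank `κ 0 + ⋯ + κ (a+1)`, that is, `B_{a+1,a}`
has (generic) rank `κ (a+1)`. For `a = t` all derivatives of `ξ_t` are expressed through
`ξ_0, …, ξ_t`. -/
structure IsOsculatingSequence (z : OpenPartialHomeomorph M ℂ)
    (ξ : (a : Fin (t + 1)) → M → Matrix (Fin n) (Fin (κ a)) ℂ)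
    (B : (b a : Fin (t + 1)) → M → Matrix (Fin (κ b)) (Fin (κ a)) ℂ) : Prop where
  size_pos : ∀ a, 0 < κ a
  holomorphic : ∀ a, HolomorphicOn z (ξ a)
  holomorphic_coeff : ∀ b a, HolomorphicOn z (B b a)
  linearIndependent : ∀ p ∈ z.source,
    LinearIndependent ℂ fun (x : BlockIdx κ) (i : Fin n) => ξ x.1 p i x.2
  deriv_eq : ∀ a, ∀ p ∈ z.source, mapMat (dMinus z) (ξ a) p =
    ∑ b ∈ Finset.univ.filter (fun b : Fin (t + 1) => b.val ≤ a.val + 1), ξ b p * B b a p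
  rank_eq : ∀ a b : Fin (t + 1), b.val = a.val + 1 → ∃ p ∈ z.source, (B b a p).rank = κ b

variable (h : Matrix (Fin n) (Fin n) ℂ)

/-- The product `Π_{a-1} ⋯ Π_0` at a point, where `Π_b` is built from
`φ_b = Π_{b-1} ⋯ Π_0 ξ_b`. -/
noncomputable def projProd (x : (a : Fin (t + 1)) → Matrix (Fin n) (Fin (κ a)) ℂ) :
    (a : ℕ) → a < t + 1 → Matrix (Fin n) (Fin n) ℂ
  | 0, _ => 1
  | a + 1, ha =>
    orthProj h (projProd x a (Nat.lt_of_succ_lt ha) * x ⟨a, Nat.lt_of_succ_lt ha⟩) *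
      projProd x a (Nat.lt_of_succ_lt ha)

variable (ξ : (a : Fin (t + 1)) → M → Matrix (Fin n) (Fin (κ a)) ℂ)

/-- The blocks `φ_a = Π_{a-1} ⋯ Π_0 ξ_a` of the Frenet frame. -/
noncomputable def phi (a : Fin (t + 1)) (p : M) : Matrix (Fin n) (Fin (κ a)) ℂ :=
  projProd h (fun b => ξ b p) a.1 a.2 * ξ a p

/-- `β_a = φ_a† h φ_a`. -/
noncomputable def beta (a : Fin (t + 1)) (p : M) : Matrix (Fin (κ a)) (Fin (κ a)) ℂ :=
  (phi h ξ a p)ᴴ * h * phi h ξ a p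

/-- The Frenet frame `φ = (φ_0 ⋯ φ_t)`; its columns are the functions `f_i`. -/
noncomputable def frame (p : M) : Matrix (Fin n) (BlockIdx κ) ℂ :=
  Matrix.of fun i x => phi h ξ x.1 p i x.2

/-- `β_a⁻¹ ∂_- β_a`. -/
noncomputable def logDerivBeta (z : OpenPartialHomeomorph M ℂ) (a : Fin (t + 1)) (p : M) :
    Matrix (Fin (κ a)) (Fin (κ a)) ℂ :=
  (beta h ξ a p)⁻¹ * mapMat (dMinus z) (beta h ξ a) p

/-- The coefficients `(λ_-)^j_i` of the Frenet equations
`∂_- φ_a = φ_a β_a⁻¹ ∂_- β_a + φ_{a+1} B_{a+1,a}`. -/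
noncomputable def lamMinus (z : OpenPartialHomeomorph M ℂ)
    (B : (b a : Fin (t + 1)) → M → Matrix (Fin (κ b)) (Fin (κ a)) ℂ) (p : M) :
    Matrix (BlockIdx κ) (BlockIdx κ) ℂ :=
  Matrix.blockDiagonal' (fun a => logDerivBeta h ξ z a p) +
    Matrix.of fun y x => if y.1.val = x.1.val + 1 then B y.1 x.1 p y.2 x.2 else 0

/-- The coefficients `(λ_+)^j_i` of the Frenet equations
`∂_+ φ_a = φ_{a-1} β_{a-1}⁻¹ D_{a-1,a} β_a`, where `D_{a-1,a} = -(B_{a,a-1})†`. -/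
noncomputable def lamPlus
    (B : (b a : Fin (t + 1)) → M → Matrix (Fin (κ b)) (Fin (κ a)) ℂ) (p : M) :
    Matrix (BlockIdx κ) (BlockIdx κ) ℂ :=
  Matrix.of fun y x => if y.1.val + 1 = x.1.val then
    ((beta h ξ y.1 p)⁻¹ * (-(B x.1 y.1 p)ᴴ) * beta h ξ x.1 p) y.2 x.2 else 0

/-- The indices `μ` of the columns of the Frenet frame that do not belong to `φ_0`. -/
abbrev HorIdx (κ : Fin (t + 1) → ℕ) : Type := {x : BlockIdx κ // x.1 ≠ 0}

/-- The vector field `Ẽ^α_i = ∑_j φ^j_i ∂/∂w^j_α` on `ξ_0`. -/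
noncomputable def liftedE (x : BlockIdx κ) (α : Fin (κ 0)) (p : M) : CIdx n (κ 0) → ℂ
  | Sum.inl q => if q.2 = α then frame h ξ p q.1 x else 0
  | Sum.inr _ => 0

/-- The components in an affine chart of the vector field `E^α_μ = dπ ∘ Ẽ^α_μ` on `ψ`. -/
noncomputable def movingE (c : AffineChart n (κ 0)) (μ : HorIdx κ) (α : Fin (κ 0)) (p : M) :
    CIdx (n - κ 0) (κ 0) → ℂ :=
  push c.coordFun (ξ 0 p) (liftedE h ξ μ.1 α p)

end Frenet

end FrenetGrassmann

open FrenetGrassmann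

/-!
The Frenet equations come from differentiating orthogonal projections, the connection coefficients
from a computation in an affine chart, in which the metric is explicit and Kähler.

*The Frenet equations.* The matrix `P_a = Π_{a-1} ⋯ Π_0` is the `h`-orthogonal projection along
the span of `ξ_0, …, ξ_{a-1}` (`isOrthProjection_projProd`), and `φ_a = P_a ξ_a`. Since the `ξ_b`
are holomorphic, differentiating `P_a ξ_b = 0` for `b < a` gives `∂_+ P_a ξ_b = 0`, that is
`∂_+ P_a = ∂_+ P_a P_a`. With `P_a² = P_a` and the self-adjointness of `P_a` this yields
`P_a ∂_+ P_a = 0` and `∂_- P_a P_a = 0` (`IsOrthProjection.wirtinger`), so that `∂_- φ_a` stays in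
the image of `P_a` and `∂_+ φ_a` is orthogonal to it. The component of `∂_- φ_a` along `φ_a` is
`φ_a β_a⁻¹ ∂_- β_a`; the remaining one is found by applying `P_{a+1}`, which turns the expansion of
`∂_- ξ_a` into `φ_{a+1} B_{a+1,a}` (`frenet_minus`). The adjoint of the resulting formula
`∂_- P_a = -φ_a B_{a,a-1} β_{a-1}⁻¹ φ_{a-1}† h` is the equation for `∂_+ φ_a` (`frenet_plus_succ`).

*The moving frame is a frame.* The equations `∂_- ξ_a = ∑ ξ_b B_{ba}` are linear ordinary
differential equations with holomorphic coefficients. A functional `u` that kills all columns of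
`(ξ_0 ⋯ ξ_t)` at one point thus kills them nearby, in particular it kills `ψ` nearby, and by the
identity theorem on the connected surface everywhere. Linear fullness forces `u = 0`; hence the
Frenet frame has `n` columns (`card_blockIdx_eq`).

*The connection.* Let `Z ↦ s = P + Q Z` be the section of `π` belonging to an affine chart with
inverse blocks `A` and `C`. In this chart the metric is `tr (dZ† K dZ Δ⁻¹)`, symmetrized, with
`Δ = s† h s` and `K = Q† h Π Q`. It is Kähler (`metricDeriv_comm`), and with `L = Δ⁻¹ s† h Q` its
Levi-Civita connection is `∇_X Y = ∂_X Y - (X L Y + Y L X)` on fields of type `(1, 0)`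
(`covDeriv_eq`). The differential of `π` at `ξ_0` is `V ↦ T V (A ξ_0)⁻¹` with `T = C - Z A`, whence
`E^α_μ = T f_μ e_α (A ξ_0)⁻¹`. As `T` kills `ξ_0` and `L T = A ξ_0 β_0⁻¹ ξ_0† h - A`, where the
first summand kills the horizontal `f_μ`, the derivatives of `T` and of `A ξ_0` cancel against the
Christoffel terms up to `-T f_μ e_α β_0⁻¹ ∂_- β_0 (A ξ_0)⁻¹` (`covDeriv_movingE`). Inserting the
Frenet equations and comparing coefficients (`sum_smul_movingE_eq_iff`) gives `Λ_±`.
-/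

namespace FrenetGrassmann

/-! ### Wirtinger calculus in one complex variable -/

/-- `g` is real differentiable at `x` with Wirtinger derivatives `∂g = a` and `∂̄g = b`. -/
def HasWirtinger (g : ℂ → ℂ) (a b x : ℂ) : Prop :=
  HasFDerivAt (𝕜 := ℝ) g
    (a • ContinuousLinearMap.id ℝ ℂ + b • (Complex.conjCLE : ℂ →L[ℝ] ℂ)) x

namespace HasWirtinger

variable {f g : ℂ → ℂ} {a b a' b' x : ℂ}

theorem lineDeriv (hg : HasWirtinger g a b x) (v : ℂ) :
    deriv (fun s : ℝ => g (x + (s : ℂ) * v)) 0 = a * v + b * star v := by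
  have h1 : HasDerivAt (fun s : ℝ => x + (s : ℂ) * v) v 0 := by
    simpa using ((Complex.ofRealCLM.hasDerivAt (x := (0 : ℝ))).mul_const v).const_add x
  have h2 : HasFDerivAt (𝕜 := ℝ) g
    (a • ContinuousLinearMap.id ℝ ℂ + b • (Complex.conjCLE : ℂ →L[ℝ] ℂ))
    ((fun s : ℝ => x + (s : ℂ) * v) 0) := by
    have h3 : (fun s : ℝ => x + (s : ℂ) * v) 0 = x := by simp
    rw [h3]
    exact hg
  simpa [Function.comp_def] using (h2.comp_hasDerivAt 0 h1).deriv

theorem dHol_eq (hg : HasWirtinger g a b x) : dHol g x 1 = a := by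
  have h1 := hg.lineDeriv 1
  have h2 := hg.lineDeriv Complex.I
  simp only [dHol, smul_eq_mul, mul_one] at h1 h2 ⊢
  rw [h1, h2]
  simp only [star_one, Complex.star_def, Complex.conj_I]
  linear_combination (-(a - b) / 2) * Complex.I_sq

theorem dBar_eq (hg : HasWirtinger g a b x) : dBar g x 1 = b := by
  have h1 := hg.lineDeriv 1
  have h2 := hg.lineDeriv Complex.I
  simp only [dBar, smul_eq_mul, mul_one] at h1 h2 ⊢
  rw [h1, h2]
  simp only [star_one, Complex.star_def, Complex.conj_I]
  linear_combination ((a - b) / 2) * Complex.I_sq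

theorem unique (hg : HasWirtinger g a b x) (hg' : HasWirtinger g a' b' x) : a = a' ∧ b = b' :=
  ⟨hg.dHol_eq.symm.trans hg'.dHol_eq, hg.dBar_eq.symm.trans hg'.dBar_eq⟩

theorem congr (hg : HasWirtinger g a b x) (hfg : f =ᶠ[nhds x] g) : HasWirtinger f a b x :=
  HasFDerivAt.congr_of_eventuallyEq hg hfg

theorem congr_left (hg : HasWirtinger g a b x) (ha : a = a') : HasWirtinger g a' b x :=
  ha ▸ hg

theorem const (c : ℂ) : HasWirtinger (fun _ => c) 0 0 x := by
  refine (hasFDerivAt_const (𝕜 := ℝ) c x).congr_fderiv ?_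
  ext
  simp

theorem of_hasDerivAt (hg : HasDerivAt g a x) : HasWirtinger g a 0 x := by
  refine (hg.hasFDerivAt.restrictScalars ℝ).congr_fderiv ?_
  ext
  simp [mul_comm]

theorem add (hf : HasWirtinger f a b x) (hg : HasWirtinger g a' b' x) :
    HasWirtinger (fun y => f y + g y) (a + a') (b + b') x := by
  refine (HasFDerivAt.add hf hg).congr_fderiv ?_
  ext
  simp
  ring

theorem mul (hf : HasWirtinger f a b x) (hg : HasWirtinger g a' b' x) :
    HasWirtinger (fun y => f y * g y) (a * g x + f x * a') (b * g x + f x * b') x := by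
  refine (HasFDerivAt.mul hf hg).congr_fderiv ?_
  ext
  simp
  ring

theorem star (hf : HasWirtinger f a b x) :
    HasWirtinger (fun y => star (f y)) (star b) (star a) x := by
  refine ((Complex.conjCLE : ℂ →L[ℝ] ℂ).hasFDerivAt.comp x hf).congr_fderiv ?_
  ext
  simp
  ring

theorem sum {ι : Type*} (s : Finset ι) {f : ι → ℂ → ℂ} {a b : ι → ℂ}
    (hf : ∀ i ∈ s, HasWirtinger (f i) (a i) (b i) x) :
    HasWirtinger (fun y => ∑ i ∈ s, f i y) (∑ i ∈ s, a i) (∑ i ∈ s, b i) x := by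
  classical
  induction s using Finset.induction_on with
  | empty => simpa using const (x := x) 0
  | insert i s his ih =>
    simp only [Finset.sum_insert his]
    exact (hf i (Finset.mem_insert_self i s)).add
      (ih fun j hj => hf j (Finset.mem_insert_of_mem hj))

/-- Every real differentiable function has Wirtinger derivatives. -/
theorem of_differentiableAt (hg : DifferentiableAt ℝ g x) :
    ∃ a b, HasWirtinger g a b x := by
  set D := fderiv ℝ g x
  refine ⟨(D 1 - Complex.I * D Complex.I) / 2, (D 1 + Complex.I * D Complex.I) / 2,
    hg.hasFDerivAt.congr_fderiv ?_⟩
  ext v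
  have h1 : D v = v.re * D 1 + v.im * D Complex.I := by
    have h2 : v = v.re • (1 : ℂ) + v.im • Complex.I := by
      simp [Complex.re_add_im]
    conv_lhs => rw [h2]
    rw [map_add, map_smul, map_smul, Complex.real_smul, Complex.real_smul]
  have h2 : (starRingEnd ℂ) v = v.re - v.im * Complex.I := Complex.ext (by simp) (by simp)
  simp only [add_apply, smul_apply, ContinuousLinearMap.id_apply,
    ContinuousLinearEquiv.coe_coe, Complex.conjCLE_apply, smul_eq_mul]
  have h3 := Complex.re_add_im v
  rw [h2]
  change D v = _
  rw [h1]
  linear_combination (D 1 - Complex.I * D Complex.I) / 2 * h3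
    + (v.im : ℂ) * D Complex.I * Complex.I_sq

end HasWirtinger

/-- The matrix-valued function `F` is real differentiable at `x`, with entrywise Wirtinger
derivatives `∂F = A` and `∂̄F = B`. -/
def HasMatrixWirtinger {R S : Type*} (F : ℂ → Matrix R S ℂ) (A B : Matrix R S ℂ) (x : ℂ) : Prop :=
  ∀ i j, HasWirtinger (fun y => F y i j) (A i j) (B i j) x

namespace HasMatrixWirtinger

variable {R S T : Type*} {F F' : ℂ → Matrix R S ℂ} {A B A' B' : Matrix R S ℂ} {x : ℂ}

theorem unique (hF : HasMatrixWirtinger F A B x) (hF' : HasMatrixWirtinger F A' B' x) :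
    A = A' ∧ B = B' :=
  ⟨Matrix.ext fun i j => ((hF i j).unique (hF' i j)).1,
    Matrix.ext fun i j => ((hF i j).unique (hF' i j)).2⟩

theorem congr (hF : HasMatrixWirtinger F A B x) (h : F' =ᶠ[nhds x] F) :
    HasMatrixWirtinger F' A B x :=
  fun i j => (hF i j).congr (h.mono fun _ hy => congrFun (congrFun hy i) j)

theorem congr_left (hF : HasMatrixWirtinger F A B x) (h : A = A') :
    HasMatrixWirtinger F A' B x :=
  h ▸ hF

theorem const (C : Matrix R S ℂ) : HasMatrixWirtinger (fun _ => C) 0 0 x :=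
  fun _ _ => HasWirtinger.const _

theorem add (hF : HasMatrixWirtinger F A B x) (hF' : HasMatrixWirtinger F' A' B' x) :
    HasMatrixWirtinger (fun y => F y + F' y) (A + A') (B + B') x :=
  fun i j => (hF i j).add (hF' i j)

theorem mul [Fintype S] (hF : HasMatrixWirtinger F A B x) {G : ℂ → Matrix S T ℂ}
    {C D : Matrix S T ℂ} (hG : HasMatrixWirtinger G C D x) :
    HasMatrixWirtinger (fun y => F y * G y) (A * G x + F x * C) (B * G x + F x * D) x := by
  intro i j
  simp only [Matrix.add_apply, Matrix.mul_apply, ← Finset.sum_add_distrib]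
  exact HasWirtinger.sum _ fun l _ => (hF i l).mul (hG l j)

theorem const_mul [Fintype R] (hF : HasMatrixWirtinger F A B x) (C : Matrix T R ℂ) :
    HasMatrixWirtinger (fun y => C * F y) (C * A) (C * B) x := by
  simpa using (const (x := x) C).mul hF

theorem mul_const [Fintype S] (hF : HasMatrixWirtinger F A B x) (C : Matrix S T ℂ) :
    HasMatrixWirtinger (fun y => F y * C) (A * C) (B * C) x := by
  simpa using hF.mul (const (x := x) C)

theorem neg (hF : HasMatrixWirtinger F A B x) :
    HasMatrixWirtinger (fun y => -F y) (-A) (-B) x := by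
  intro i j
  simpa using (HasWirtinger.const (x := x) (-1)).mul (hF i j)

theorem sub (hF : HasMatrixWirtinger F A B x) (hF' : HasMatrixWirtinger F' A' B' x) :
    HasMatrixWirtinger (fun y => F y - F' y) (A - A') (B - B') x := by
  simpa only [sub_eq_add_neg] using hF.add hF'.neg

theorem conjTranspose (hF : HasMatrixWirtinger F A B x) :
    HasMatrixWirtinger (fun y => (F y)ᴴ) Bᴴ Aᴴ x :=
  fun i j => (hF j i).star

/-- The affine function `ζ ↦ W + ζ V`. -/
theorem slice (W V : Matrix R S ℂ) : HasMatrixWirtinger (fun ζ => W + ζ • V) V 0 x := by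
  intro i j
  refine HasWirtinger.of_hasDerivAt ?_
  simpa using ((hasDerivAt_id x).mul_const (V i j)).const_add (W i j)

theorem differentiableAt (hF : HasMatrixWirtinger F A B x) (i : R) (j : S) :
    DifferentiableAt ℝ (fun y => F y i j) x :=
  HasFDerivAt.differentiableAt (hF i j)

theorem differentiableAt_det [Fintype R] [DecidableEq R] {F : ℂ → Matrix R R ℂ}
    (hF : ∀ i j, DifferentiableAt ℝ (fun y => F y i j) x) :
    DifferentiableAt ℝ (fun y => (F y).det) x := by
  simp only [Matrix.det_apply]
  refine DifferentiableAt.fun_sum fun σ _ => DifferentiableAt.const_smul ?_ _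
  exact (HasFDerivAt.finsetProd (g := fun i y => F y (σ i) i)
    fun i _ => (hF (σ i) i).hasFDerivAt).differentiableAt

theorem eventually_isUnit [Fintype R] [DecidableEq R] {F : ℂ → Matrix R R ℂ} {A B : Matrix R R ℂ}
    (hF : HasMatrixWirtinger F A B x) (hx : IsUnit (F x).det) :
    ∀ᶠ y in nhds x, IsUnit (F y).det := by
  have h1 := (differentiableAt_det hF.differentiableAt).continuousAt
  filter_upwards [h1.eventually_ne hx.ne_zero] with y hy using isUnit_iff_ne_zero.2 hy

theorem inv [Fintype R] [DecidableEq R] {F : ℂ → Matrix R R ℂ} {A B : Matrix R R ℂ}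
    (hF : HasMatrixWirtinger F A B x) (hx : IsUnit (F x).det) :
    HasMatrixWirtinger (fun y => (F y)⁻¹) (-((F x)⁻¹ * A * (F x)⁻¹))
      (-((F x)⁻¹ * B * (F x)⁻¹)) x := by
  have h1 : ∀ i j, ∃ a b, HasWirtinger (fun y => (F y)⁻¹ i j) a b x := by
    intro i j
    apply HasWirtinger.of_differentiableAt
    simp only [Matrix.inv_def, Ring.inverse_eq_inv', Matrix.smul_apply, smul_eq_mul]
    refine ((differentiableAt_det hF.differentiableAt).inv hx.ne_zero).mul ?_
    simp only [Matrix.adjugate_apply]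
    refine differentiableAt_det fun k l => ?_
    by_cases h : k = j
    · subst h
      simp
    · simpa [Matrix.updateRow_ne h] using hF.differentiableAt k l
  choose C D hCD using h1
  have hG : HasMatrixWirtinger (fun y => (F y)⁻¹) (Matrix.of C) (Matrix.of D) x :=
    fun i j => hCD i j
  have h2 := (hF.mul hG).unique ((const (x := x) (1 : Matrix R R ℂ)).congr
    ((hF.eventually_isUnit hx).mono fun y hy => Matrix.mul_nonsing_inv _ hy))
  have key : ∀ U V : Matrix R R ℂ, U * (F x)⁻¹ + F x * V = 0 → V = -((F x)⁻¹ * U * (F x)⁻¹) := by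
    intro U V h
    have := congrArg ((F x)⁻¹ * ·) h
    simp only [Matrix.mul_add, Matrix.mul_zero, ← Matrix.mul_assoc,
      Matrix.nonsing_inv_mul _ hx, Matrix.one_mul] at this
    exact eq_neg_of_add_eq_zero_right this
  rwa [key _ _ h2.1, key _ _ h2.2] at hG

end HasMatrixWirtinger

theorem coordDeriv_inl_eq {r s : ℕ} {f : Matrix (Fin r) (Fin s) ℂ → ℂ}
    {w : Matrix (Fin r) (Fin s) ℂ} {q : Fin r × Fin s} {a b : ℂ}
    (hf : HasWirtinger (fun ζ => f (w + ζ • Matrix.single q.1 q.2 1)) a b 0) :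
    coordDeriv f w (Sum.inl q) = a := by
  simpa [coordDeriv, dHol] using hf.dHol_eq

theorem coordDeriv_inr_eq {r s : ℕ} {f : Matrix (Fin r) (Fin s) ℂ → ℂ}
    {w : Matrix (Fin r) (Fin s) ℂ} {q : Fin r × Fin s} {a b : ℂ}
    (hf : HasWirtinger (fun ζ => f (w + ζ • Matrix.single q.1 q.2 1)) a b 0) :
    coordDeriv f w (Sum.inr q) = b := by
  simpa [coordDeriv, dBar] using hf.dBar_eq

section

variable {M : Type*} [TopologicalSpace M] {z : OpenPartialHomeomorph M ℂ} {p : M} {R S : Type*}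
  {F : M → Matrix R S ℂ} {A B : Matrix R S ℂ}

theorem mapMat_dMinus_eq (hF : HasMatrixWirtinger (fun ζ => F (z.symm ζ)) A B (z p)) :
    mapMat (dMinus z) F p = A :=
  Matrix.ext fun i j => (hF i j).dHol_eq

theorem mapMat_dPlus_eq (hF : HasMatrixWirtinger (fun ζ => F (z.symm ζ)) A B (z p)) :
    mapMat (dPlus z) F p = B :=
  Matrix.ext fun i j => (hF i j).dBar_eq

/-- A holomorphic function has the Wirtinger derivatives `∂_- F` and `0`. -/
theorem HolomorphicOn.hasMatrixWirtinger (hF : HolomorphicOn z F) (hp : p ∈ z.source) :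
    HasMatrixWirtinger (fun ζ => F (z.symm ζ)) (mapMat (dMinus z) F p) 0 (z p) := by
  have h1 : ∀ i j, HasWirtinger (fun ζ => F (z.symm ζ) i j)
      (deriv (fun ζ => F (z.symm ζ) i j) (z p)) 0 (z p) := fun i j =>
    .of_hasDerivAt ((hF i j).differentiableAt
      (z.open_target.mem_nhds (z.map_source hp))).hasDerivAt
  have h2 : HasMatrixWirtinger (fun ζ => F (z.symm ζ))
      (Matrix.of fun i j => deriv (fun ζ => F (z.symm ζ) i j) (z p)) 0 (z p) := h1
  rwa [← mapMat_dMinus_eq h2] at h2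

end

/-! ### The Gram–Schmidt process for blocks of columns -/

section GramSchmidt

variable {n r m : ℕ} {h : Matrix (Fin n) (Fin n) ℂ}

theorem isUnit_det_gram (hh : h.PosDef) {w : Matrix (Fin n) (Fin r) ℂ}
    (hw : Function.Injective w.mulVec) : IsUnit (wᴴ * h * w).det :=
  (Matrix.isUnit_iff_isUnit_det _).1 (hh.conjTranspose_mul_mul_same hw).isUnit

theorem mulVec_injective_of_left_inverse {w : Matrix (Fin n) (Fin r) ℂ}
    {K : Matrix (Fin r) (Fin n) ℂ} (hK : K * w = 1) : Function.Injective w.mulVec := by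
  intro u v huv
  have := congrArg K.mulVec huv
  simpa [Matrix.mulVec_mulVec, hK] using this

theorem orthProj_mul_self {w : Matrix (Fin n) (Fin r) ℂ}
    (hw : IsUnit (wᴴ * h * w).det) : orthProj h w * w = 0 := by
  rw [orthProj, Matrix.sub_mul, Matrix.one_mul, sub_eq_zero]
  rw [show w * (wᴴ * h * w)⁻¹ * wᴴ * h * w = w * ((wᴴ * h * w)⁻¹ * (wᴴ * h * w)) by
    simp only [Matrix.mul_assoc], Matrix.nonsing_inv_mul _ hw, Matrix.mul_one]

theorem conjTranspose_gram (hh : h.IsHermitian) (w : Matrix (Fin n) (Fin r) ℂ) :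
    (wᴴ * h * w)ᴴ = wᴴ * h * w := by
  simp [Matrix.conjTranspose_mul, hh.eq, Matrix.mul_assoc]

theorem conjTranspose_gram_inv (hh : h.IsHermitian) (w : Matrix (Fin n) (Fin r) ℂ) :
    ((wᴴ * h * w)⁻¹)ᴴ = (wᴴ * h * w)⁻¹ := by
  rw [Matrix.conjTranspose_nonsing_inv, conjTranspose_gram hh]

theorem mul_orthProj_of_mul_eq_zero {R : Type*} {w : Matrix (Fin n) (Fin r) ℂ}
    {K : Matrix R (Fin n) ℂ} (hK : K * w = 0) : K * orthProj h w = K := by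
  rw [orthProj, Matrix.mul_sub, Matrix.mul_one, Matrix.mul_assoc w, Matrix.mul_assoc w,
    ← Matrix.mul_assoc K, hK, Matrix.zero_mul, sub_zero]

/-- `P` is an `h`-orthogonal projection: an idempotent that is self-adjoint with respect to the
hermitian form `h`. -/
structure IsOrthProjection (h P : Matrix (Fin n) (Fin n) ℂ) : Prop where
  mul_self : P * P = P
  selfAdjoint : h * P = Pᴴ * h

namespace IsOrthProjection

variable {P : Matrix (Fin n) (Fin n) ℂ} {X : Matrix (Fin n) (Fin r) ℂ}

theorem adjoint_block_mul (hP : IsOrthProjection h P) : (P * X)ᴴ * h * P = (P * X)ᴴ * h := by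
  rw [Matrix.mul_assoc, hP.selfAdjoint, ← Matrix.mul_assoc, ← Matrix.conjTranspose_mul,
    ← Matrix.mul_assoc, hP.mul_self]

/-- For `φ = P X` the Gram matrix `φ† h φ` can be computed with one factor `X`. -/
theorem gram_eq (hP : IsOrthProjection h P) :
    (P * X)ᴴ * h * X = (P * X)ᴴ * h * (P * X) := by
  rw [← Matrix.mul_assoc _ P, hP.adjoint_block_mul]

theorem orthProj_mul (hP : IsOrthProjection h P) :
    orthProj h (P * X) * P = P - P * X * ((P * X)ᴴ * h * (P * X))⁻¹ * (P * X)ᴴ * h := by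
  rw [orthProj, Matrix.sub_mul, Matrix.one_mul, Matrix.mul_assoc _ h P,
    Matrix.mul_assoc _ (P * X)ᴴ, ← Matrix.mul_assoc (P * X)ᴴ, hP.adjoint_block_mul,
    ← Matrix.mul_assoc]

theorem mul_orthProj_mul (hP : IsOrthProjection h P) :
    P * (orthProj h (P * X) * P) = orthProj h (P * X) * P := by
  rw [hP.orthProj_mul, Matrix.mul_sub, hP.mul_self]
  simp only [← Matrix.mul_assoc]
  rw [hP.mul_self]

/-- One step of the Gram–Schmidt process: removing the span of the projected block `P X` from the
image of `P` leaves an `h`-orthogonal projection. -/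
theorem step (hP : IsOrthProjection h P) (hh : h.IsHermitian)
    (hX : IsUnit ((P * X)ᴴ * h * (P * X)).det) :
    IsOrthProjection h (orthProj h (P * X) * P) where
  mul_self := by
    rw [Matrix.mul_assoc, hP.mul_orthProj_mul]
    conv_lhs => rw [← Matrix.mul_assoc]
    congr 1
    apply mul_orthProj_of_mul_eq_zero
    exact orthProj_mul_self hX
  selfAdjoint := by
    rw [hP.orthProj_mul, Matrix.conjTranspose_sub, Matrix.mul_sub, Matrix.sub_mul,
      hP.selfAdjoint]
    congr 1
    have h1 := conjTranspose_gram_inv hh (P * X)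
    simp only [Matrix.conjTranspose_mul, hh.eq, Matrix.mul_assoc,
      Matrix.conjTranspose_conjTranspose] at h1 ⊢
    rw [h1]

end IsOrthProjection

end GramSchmidt

section Blocks

variable {M : Type*} {n t : ℕ} {κ : Fin (t + 1) → ℕ} {h : Matrix (Fin n) (Fin n) ℂ}
  {ξ : (a : Fin (t + 1)) → M → Matrix (Fin n) (Fin (κ a)) ℂ} {p : M}

/-- A matrix that kills the blocks `ξ_b`, `b < a`, does not see the projection
`Π_{a-1} ⋯ Π_0` along these blocks. -/
theorem mul_projProd {R : Type*} {K : Matrix R (Fin n) ℂ} : ∀ (a : ℕ) (ha : a < t + 1),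
    (∀ b : Fin (t + 1), b.1 < a → K * ξ b p = 0) →
      K * projProd h (fun b => ξ b p) a ha = K
  | 0, _, _ => by rw [projProd, Matrix.mul_one]
  | a + 1, ha, hK => by
    have ih := mul_projProd a (Nat.lt_of_succ_lt ha)
      fun b hb => hK b (Nat.lt_succ_of_lt hb)
    rw [projProd, ← Matrix.mul_assoc, mul_orthProj_of_mul_eq_zero, ih]
    rw [← Matrix.mul_assoc, ih]
    exact hK ⟨a, _⟩ (Nat.lt_succ_self a)

theorem mul_phi {R : Type*} {K : Matrix R (Fin n) ℂ} {a : Fin (t + 1)}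
    (hK : ∀ b < a, K * ξ b p = 0) : K * phi h ξ a p = K * ξ a p := by
  rw [phi, ← Matrix.mul_assoc, mul_projProd _ _ fun b hb => hK b hb]

variable (hξ : LinearIndependent ℂ fun (x : BlockIdx κ) (i : Fin n) => ξ x.1 p i x.2)
include hξ

theorem exists_left_inverse_block (a : Fin (t + 1)) :
    ∃ K : Matrix (Fin (κ a)) (Fin n) ℂ, K * ξ a p = 1 ∧ ∀ b ≠ a, K * ξ b p = 0 := by
  let X : Matrix (Fin n) (BlockIdx κ) ℂ := Matrix.of fun i x => ξ x.1 p i x.2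
  have hX : Function.Injective X.mulVec := Matrix.mulVec_injective_iff.2 hξ
  obtain ⟨L, hL⟩ := LinearMap.exists_leftInverse_of_injective X.mulVecLin
    (LinearMap.ker_eq_bot.2 hX)
  have h1 : LinearMap.toMatrix' L * X = 1 := by
    have := congrArg LinearMap.toMatrix' hL
    rwa [LinearMap.toMatrix'_comp, LinearMap.toMatrix'_id,
      show LinearMap.toMatrix' X.mulVecLin = X from LinearMap.toMatrix'_toLin' X] at this
  have h2 : ∀ x y : BlockIdx κ,
      ∑ i, LinearMap.toMatrix' L x i * ξ y.1 p i y.2 = if x = y then 1 else 0 := by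
    intro x y
    have := congrFun (congrFun h1 x) y
    rwa [Matrix.mul_apply, Matrix.one_apply] at this
  refine ⟨Matrix.of fun j i => LinearMap.toMatrix' L ⟨a, j⟩ i, ?_, fun b hb => ?_⟩
  · ext j l
    rw [Matrix.mul_apply, Matrix.one_apply]
    refine (h2 ⟨a, j⟩ ⟨a, l⟩).trans ?_
    simp
  · ext j l
    rw [Matrix.mul_apply]
    refine (h2 ⟨a, j⟩ ⟨b, l⟩).trans ?_
    rw [if_neg, Matrix.zero_apply]
    intro h
    exact hb (congrArg Sigma.fst h).symm

/-- The blocks `φ_a` have full rank: a left inverse of `ξ_a` that kills the preceding blocks is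
also one of `φ_a`. -/
theorem phi_mulVec_injective (a : Fin (t + 1)) : Function.Injective (phi h ξ a p).mulVec := by
  obtain ⟨K, hK, hK'⟩ := exists_left_inverse_block hξ a
  refine mulVec_injective_of_left_inverse (K := K) ?_
  rw [mul_phi fun b hb => hK' b hb.ne, hK]

variable (hh : h.PosDef)
include hh

theorem isUnit_det_beta (a : Fin (t + 1)) : IsUnit (beta h ξ a p).det :=
  isUnit_det_gram hh (phi_mulVec_injective hξ a)

theorem isOrthProjection_projProd : ∀ (a : ℕ) (ha : a < t + 1),
    IsOrthProjection h (projProd h (fun b => ξ b p) a ha)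
  | 0, _ => ⟨by simp [projProd], by simp [projProd]⟩
  | a + 1, ha => (isOrthProjection_projProd a (Nat.lt_of_succ_lt ha)).step hh.1
      (isUnit_det_beta hξ hh ⟨a, Nat.lt_of_succ_lt ha⟩)

theorem projProd_mul_eq_zero : ∀ (a : ℕ) (ha : a < t + 1) (b : Fin (t + 1)), b.1 < a →
    projProd h (fun b => ξ b p) a ha * ξ b p = 0
  | 0, _, b, hb => absurd hb (Nat.not_lt_zero _)
  | a + 1, ha, b, hb => by
    rw [projProd, Matrix.mul_assoc]
    rcases Nat.lt_succ_iff_lt_or_eq.1 hb with hb | hb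
    · rw [projProd_mul_eq_zero a _ b hb, Matrix.mul_zero]
    · obtain rfl : b = ⟨a, Nat.lt_of_succ_lt ha⟩ := Fin.ext hb
      exact orthProj_mul_self (isUnit_det_beta hξ hh ⟨a, Nat.lt_of_succ_lt ha⟩)

theorem projProd_mul_phi (a : Fin (t + 1)) :
    projProd h (fun b => ξ b p) a.1 a.2 * phi h ξ a p = phi h ξ a p := by
  rw [phi, ← Matrix.mul_assoc, (isOrthProjection_projProd hξ hh a.1 a.2).mul_self]

theorem orthProj_phi_mul_eq_zero (a b : Fin (t + 1)) (hb : b ≤ a) :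
    orthProj h (phi h ξ a p) * projProd h (fun b => ξ b p) a.1 a.2 * ξ b p = 0 := by
  rw [Matrix.mul_assoc]
  rcases hb.lt_or_eq with hb | rfl
  · rw [projProd_mul_eq_zero hξ hh a.1 a.2 b hb, Matrix.mul_zero]
  · exact orthProj_mul_self (isUnit_det_beta hξ hh b)

theorem phi_orthogonal {a b : Fin (t + 1)} (hab : a ≠ b) :
    (phi h ξ a p)ᴴ * h * phi h ξ b p = 0 := by
  have key : ∀ {a b : Fin (t + 1)}, a < b → (phi h ξ a p)ᴴ * h * phi h ξ b p = 0 := by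
    intro a b hab
    have hP := isOrthProjection_projProd hξ hh b.1 b.2
    have h1 : projProd h (fun b => ξ b p) b.1 b.2 * phi h ξ a p = 0 := by
      rw [mul_phi, projProd_mul_eq_zero hξ hh b.1 b.2 a hab]
      exact fun c hc => projProd_mul_eq_zero hξ hh b.1 b.2 c (hc.trans hab)
    rw [phi.eq_def h ξ b, Matrix.mul_assoc, ← Matrix.mul_assoc h, hP.selfAdjoint,
      ← Matrix.mul_assoc, ← Matrix.mul_assoc, ← Matrix.conjTranspose_mul, h1]
    simp
  rcases lt_or_gt_of_ne hab with h1 | h1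
  · exact key h1
  · have := congrArg Matrix.conjTranspose (key h1)
    simpa [Matrix.conjTranspose_mul, hh.1.eq, Matrix.mul_assoc] using this

end Blocks

/-! ### The Frenet equations -/

section FrenetEquations

/-- A family of `h`-orthogonal projections `P` whose `∂̄`-derivative kills the kernel of `P`:
the `∂̄`-derivative then maps into this kernel, and the `∂`-derivative kills the image of `P`. -/
theorem IsOrthProjection.wirtinger {n : ℕ} {h : Matrix (Fin n) (Fin n) ℂ} (hh : h.PosDef)
    {P : ℂ → Matrix (Fin n) (Fin n) ℂ} {A B : Matrix (Fin n) (Fin n) ℂ} {x : ℂ}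
    (hP : ∀ᶠ y in nhds x, IsOrthProjection h (P y)) (hAB : HasMatrixWirtinger P A B x)
    (hB : B * P x = B) : P x * B = 0 ∧ A * P x = 0 ∧ h * B = Aᴴ * h := by
  have hu : IsUnit h.det := (Matrix.isUnit_iff_isUnit_det _).1 hh.isUnit
  have h1 := ((hAB.mul hAB).unique (hAB.congr (hP.mono fun y hy => hy.mul_self))).2
  rw [hB, add_eq_left] at h1
  have h2 := ((hAB.const_mul h).unique ((hAB.conjTranspose.mul_const h).congr
    (hP.mono fun y hy => hy.selfAdjoint))).2
  refine ⟨h1, ?_, h2⟩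
  have h3 : (A * P x)ᴴ * h = 0 := by
    rw [Matrix.conjTranspose_mul, Matrix.mul_assoc, ← h2, ← Matrix.mul_assoc,
      ← hP.self_of_nhds.selfAdjoint, Matrix.mul_assoc, h1, Matrix.mul_zero]
  have h4 : (A * P x)ᴴ = 0 := by
    have := congrArg (· * h⁻¹) h3
    simpa [Matrix.mul_assoc, Matrix.mul_nonsing_inv _ hu] using this
  simpa using congrArg Matrix.conjTranspose h4

/-- The projection `Π` built from a differentiable block is differentiable. Its derivatives are not
needed explicitly. -/
theorem HasMatrixWirtinger.orthProj {n r : ℕ} {h : Matrix (Fin n) (Fin n) ℂ}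
    {F : ℂ → Matrix (Fin n) (Fin r) ℂ} {A B : Matrix (Fin n) (Fin r) ℂ} {x : ℂ}
    (hF : HasMatrixWirtinger F A B x) (hu : IsUnit ((F x)ᴴ * h * F x).det) :
    ∃ C D, HasMatrixWirtinger (fun y => FrenetGrassmann.orthProj h (F y)) C D x :=
  ⟨_, _, (const 1).sub (((hF.mul (((hF.conjTranspose.mul_const h).mul hF).inv hu)).mul
    hF.conjTranspose).mul_const h)⟩

variable {M : Type*} [TopologicalSpace M] {n t : ℕ} {κ : Fin (t + 1) → ℕ}
  {h : Matrix (Fin n) (Fin n) ℂ} {z : OpenPartialHomeomorph M ℂ}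
  {ξ : (a : Fin (t + 1)) → M → Matrix (Fin n) (Fin (κ a)) ℂ}
  {B : (b a : Fin (t + 1)) → M → Matrix (Fin (κ b)) (Fin (κ a)) ℂ} {p : M}

theorem eventually_symm_mem_source (hp : p ∈ z.source) :
    ∀ᶠ y in nhds (z p), z.symm y ∈ z.source :=
  Filter.mem_of_superset (z.open_target.mem_nhds (z.map_source hp)) fun _ => z.map_target

variable (hh : h.PosDef) (hξ : IsOsculatingSequence z ξ B) (hp : p ∈ z.source)
include hh hξ hp

theorem exists_hasMatrixWirtinger_projProd : ∀ (a : ℕ) (ha : a < t + 1), ∃ C D,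
    HasMatrixWirtinger (fun y => projProd h (fun b => ξ b (z.symm y)) a ha) C D (z p)
  | 0, _ => ⟨0, 0, HasMatrixWirtinger.const 1⟩
  | a + 1, ha => by
    obtain ⟨C, D, hP⟩ := exists_hasMatrixWirtinger_projProd a (Nat.lt_of_succ_lt ha)
    have hφ := hP.mul ((hξ.holomorphic ⟨a, Nat.lt_of_succ_lt ha⟩).hasMatrixWirtinger hp)
    obtain ⟨C', D', hQ⟩ := hφ.orthProj (h := h) (by
      have := isUnit_det_beta (hξ.linearIndependent p hp) hh ⟨a, Nat.lt_of_succ_lt ha⟩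
      rw [z.left_inv hp]
      exact this)
    exact ⟨_, _, hQ.mul hP⟩

theorem exists_hasMatrixWirtinger_phi (a : Fin (t + 1)) : ∃ C D,
    HasMatrixWirtinger (fun y => phi h ξ a (z.symm y)) C D (z p) := by
  obtain ⟨C, D, hP⟩ := exists_hasMatrixWirtinger_projProd hh hξ hp a.1 a.2
  exact ⟨_, _, hP.mul ((hξ.holomorphic a).hasMatrixWirtinger hp)⟩

omit hh in
/-- If `P ξ_b = 0` near `p` for a holomorphic block `ξ_b`, then `∂P ξ_b = -P ∂ξ_b` and
`∂̄P ξ_b = 0`. -/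
theorem wirtinger_mul_block {P : ℂ → Matrix (Fin n) (Fin n) ℂ} {C D : Matrix (Fin n) (Fin n) ℂ}
    (hP : HasMatrixWirtinger P C D (z p)) {b : Fin (t + 1)}
    (hb : ∀ᶠ y in nhds (z p), P y * ξ b (z.symm y) = 0) :
    C * ξ b p = -(P (z p) * mapMat (dMinus z) (ξ b) p) ∧ D * ξ b p = 0 := by
  have h1 := (hP.mul ((hξ.holomorphic b).hasMatrixWirtinger hp)).unique
    ((HasMatrixWirtinger.const 0).congr hb)
  rw [z.left_inv hp, Matrix.mul_zero, add_zero] at h1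
  exact ⟨eq_neg_of_add_eq_zero_left h1.1, h1.2⟩

omit hh in
theorem mul_mapMat_block_eq_zero {R : Type*} {K : Matrix R (Fin n) ℂ} {b : Fin (t + 1)}
    (hK : ∀ a : Fin (t + 1), a.1 ≤ b.1 + 1 → K * ξ a p = 0) :
    K * mapMat (dMinus z) (ξ b) p = 0 := by
  rw [hξ.deriv_eq b p hp, Matrix.mul_sum]
  refine Finset.sum_eq_zero fun a ha => ?_
  rw [← Matrix.mul_assoc, hK a (Finset.mem_filter.1 ha).2, Matrix.zero_mul]

/-- The derivatives of the projection `P = Π_{a-1} ⋯ Π_0`. -/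
theorem wirtinger_projProd (a : Fin (t + 1)) {C D : Matrix (Fin n) (Fin n) ℂ}
    (hP : HasMatrixWirtinger (fun y => projProd h (fun b => ξ b (z.symm y)) a.1 a.2) C D (z p)) :
    projProd h (fun b => ξ b p) a.1 a.2 * D = 0 ∧ C * projProd h (fun b => ξ b p) a.1 a.2 = 0 ∧
      h * D = Cᴴ * h ∧ ∀ b < a, C * ξ b p =
        -(projProd h (fun b => ξ b p) a.1 a.2 * mapMat (dMinus z) (ξ b) p) := by
  have hs := eventually_symm_mem_source hp
  have h1 : ∀ b < a, _ := fun b hb => wirtinger_mul_block hξ hp hP (b := b)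
    (hs.mono fun y hy => projProd_mul_eq_zero (hξ.linearIndependent _ hy) hh a.1 a.2 b hb)
  have h2 : D * projProd h (fun b => ξ b p) a.1 a.2 = D :=
    mul_projProd _ _ fun b hb => (h1 b hb).2
  have h3 := IsOrthProjection.wirtinger hh (hs.mono fun y hy =>
    isOrthProjection_projProd (hξ.linearIndependent _ hy) hh a.1 a.2) hP
    (by rw [z.left_inv hp]; exact h2)
  rw [z.left_inv hp] at h3
  refine ⟨h3.1, h3.2.1, h3.2.2, fun b hb => ?_⟩
  have := (h1 b hb).1
  rwa [z.left_inv hp] at this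

/-- The Wirtinger derivatives of the blocks of the Frenet frame, in terms of those of the
projections. -/
theorem wirtinger_phi (a : Fin (t + 1)) {C D : Matrix (Fin n) (Fin n) ℂ}
    {C' D' : Matrix (Fin n) (Fin (κ a)) ℂ}
    (hP : HasMatrixWirtinger (fun y => projProd h (fun b => ξ b (z.symm y)) a.1 a.2) C D (z p))
    (hφ : HasMatrixWirtinger (fun y => phi h ξ a (z.symm y)) C' D' (z p)) :
    projProd h (fun b => ξ b p) a.1 a.2 * C' = C' ∧ D' = D * ξ a p := by
  obtain ⟨-, h2, -, -⟩ := wirtinger_projProd hh hξ hp a hP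
  have hs := eventually_symm_mem_source hp
  constructor
  · have h3 := ((hP.mul hφ).unique (hφ.congr (hs.mono fun y hy => by
      exact projProd_mul_phi (hξ.linearIndependent _ hy) hh a))).1
    rw [z.left_inv hp] at h3
    rwa [phi, ← Matrix.mul_assoc, h2, Matrix.zero_mul, zero_add] at h3
  · have h3 := (hφ.unique (hP.mul ((hξ.holomorphic a).hasMatrixWirtinger hp))).2
    rwa [z.left_inv hp, Matrix.mul_zero, add_zero] at h3

/-- `∂_+ φ_a` is orthogonal to `φ_a`, so that `∂_- β_a = φ_a† h ∂_- φ_a`. -/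
theorem logDerivBeta_eq (a : Fin (t + 1)) {C D : Matrix (Fin n) (Fin (κ a)) ℂ}
    (hφ : HasMatrixWirtinger (fun y => phi h ξ a (z.symm y)) C D (z p)) :
    logDerivBeta h ξ z a p = (beta h ξ a p)⁻¹ * ((phi h ξ a p)ᴴ * h * C) := by
  obtain ⟨C', D', hP⟩ := exists_hasMatrixWirtinger_projProd hh hξ hp a.1 a.2
  have hD := (wirtinger_phi hh hξ hp a hP hφ).2
  have hPD := (wirtinger_projProd hh hξ hp a hP).1
  have hO := isOrthProjection_projProd (hξ.linearIndependent _ hp) hh a.1 a.2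
  have h1 : (phi h ξ a p)ᴴ * h * D = 0 := by
    rw [phi, ← hO.adjoint_block_mul, hD, Matrix.mul_assoc,
      ← Matrix.mul_assoc (projProd _ _ _ _) D', hPD, Matrix.zero_mul, Matrix.mul_zero]
  have h2 : Dᴴ * h * phi h ξ a p = 0 := by
    have := congrArg Matrix.conjTranspose h1
    simpa [Matrix.conjTranspose_mul, hh.1.eq, Matrix.mul_assoc] using this
  have h3 := mapMat_dMinus_eq (F := beta h ξ a) ((hφ.conjTranspose.mul_const h).mul hφ)
  rw [z.left_inv hp, h2, zero_add] at h3
  rw [logDerivBeta, h3]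

/-- `∂_- φ_a = φ_a β_a⁻¹ ∂_- β_a + φ_{a+1} B_{a+1,a}`, where the second summand is written as a
sum over the indices `b = a + 1`, so that it is absent for `a = t`. -/
theorem frenet_minus (a : Fin (t + 1)) {C D : Matrix (Fin n) (Fin (κ a)) ℂ}
    (hφ : HasMatrixWirtinger (fun y => phi h ξ a (z.symm y)) C D (z p)) :
    C = phi h ξ a p * logDerivBeta h ξ z a p +
      ∑ b, if b.1 = a.1 + 1 then phi h ξ b p * B b a p else 0 := by
  obtain ⟨C', D', hP⟩ := exists_hasMatrixWirtinger_projProd hh hξ hp a.1 a.2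
  have hu := isUnit_det_beta (hξ.linearIndependent p hp) hh a
  obtain ⟨E, G, hO⟩ := hφ.orthProj (h := h) (by rwa [z.left_inv hp])
  have hs := eventually_symm_mem_source hp
  set N : ℂ → Matrix (Fin n) (Fin n) ℂ := fun y => orthProj h (phi h ξ a (z.symm y)) *
    projProd h (fun b => ξ b (z.symm y)) a.1 a.2 with hNdef
  obtain ⟨E', G', hN⟩ : ∃ E' G', HasMatrixWirtinger N E' G' (z p) := ⟨_, _, hO.mul hP⟩
  have hNp : N (z p) = orthProj h (phi h ξ a p) * projProd h (fun b => ξ b p) a.1 a.2 := by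
    simp only [hNdef, z.left_inv hp]
  have hN0 : ∀ b ≤ a, ∀ᶠ y in nhds (z p), N y * ξ b (z.symm y) = 0 := fun b hb =>
    hs.mono fun y hy => orthProj_phi_mul_eq_zero (hξ.linearIndependent _ hy) hh a b hb
  have hN0p : ∀ b ≤ a, N (z p) * ξ b p = 0 := fun b hb => by
    have := (hN0 b hb).self_of_nhds
    rwa [z.left_inv hp] at this
  have hNφ : ∀ᶠ y in nhds (z p), N y * phi h ξ a (z.symm y) = 0 := hs.mono fun y hy => by
    have hO := fun b hb => orthProj_phi_mul_eq_zero (hξ.linearIndependent _ hy) hh a b hb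
    rw [mul_phi fun b hb => hO b hb.le]
    exact hO a le_rfl
  have h1 := ((hN.mul hφ).unique ((HasMatrixWirtinger.const 0).congr hNφ)).1
  rw [z.left_inv hp] at h1
  -- differentiating `N φ_a = 0` gives `N ∂φ_a = -∂N φ_a = -∂N ξ_a = N ∂ξ_a`
  rw [mul_phi, (wirtinger_mul_block hξ hp hN (hN0 a le_rfl)).1, neg_add_eq_zero] at h1
  swap
  · intro b hb
    rw [(wirtinger_mul_block hξ hp hN (hN0 b hb.le)).1, neg_eq_zero]
    exact mul_mapMat_block_eq_zero hξ hp fun c hc => hN0p c (by omega)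
  have h2 : N (z p) * C = C - phi h ξ a p * logDerivBeta h ξ z a p := by
    rw [hNp, Matrix.mul_assoc, (wirtinger_phi hh hξ hp a hP hφ).1,
      logDerivBeta_eq hh hξ hp a hφ, orthProj, Matrix.sub_mul, Matrix.one_mul]
    simp only [beta, Matrix.mul_assoc]
  have h3 : N (z p) * mapMat (dMinus z) (ξ a) p =
      ∑ b, if b.1 = a.1 + 1 then phi h ξ b p * B b a p else 0 := by
    rw [hξ.deriv_eq a p hp, Finset.sum_filter, Matrix.mul_sum]
    refine Finset.sum_congr rfl fun b _ => ?_
    rcases lt_trichotomy b.1 (a.1 + 1) with hb | hb | hb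
    · rw [if_pos hb.le, if_neg hb.ne, ← Matrix.mul_assoc, hN0p b (by omega), Matrix.zero_mul]
    · obtain ⟨b, hb'⟩ := b
      subst hb
      rw [if_pos le_rfl, if_pos rfl, ← Matrix.mul_assoc, hNp]
      rfl
    · rw [if_neg (by omega), if_neg (by omega), Matrix.mul_zero]
  rw [← h3, h1, h2, add_sub_cancel]

/-- `∂_+ φ_a = -φ_c β_c⁻¹ B_{ac}† β_a` for `a = c + 1`. -/
theorem frenet_plus_succ (a c : Fin (t + 1)) (hac : c.1 + 1 = a.1)
    {C D : Matrix (Fin n) (Fin (κ a)) ℂ}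
    (hφ : HasMatrixWirtinger (fun y => phi h ξ a (z.symm y)) C D (z p)) :
    D = phi h ξ c p * ((beta h ξ c p)⁻¹ * (-(B a c p)ᴴ) * beta h ξ a p) := by
  have hli := hξ.linearIndependent p hp
  obtain ⟨C', D', hP⟩ := exists_hasMatrixWirtinger_projProd hh hξ hp a.1 a.2
  have hD := (wirtinger_phi hh hξ hp a hP hφ).2
  obtain ⟨-, h2, h3, h4⟩ := wirtinger_projProd hh hξ hp a hP
  have hOa := isOrthProjection_projProd hli hh a.1 a.2
  have hOc := isOrthProjection_projProd hli hh c.1 c.2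
  have hca : c < a := Fin.lt_def.2 (by omega)
  have hu : IsUnit h.det := (Matrix.isUnit_iff_isUnit_det _).1 hh.isUnit
  -- `∂P` kills `ξ_b` for `b < c` and sends `ξ_c` to `-φ_a B_{ac}`
  have hb0 : ∀ b < c, C' * ξ b p = 0 := fun b hb => by
    rw [h4 b (hb.trans hca), neg_eq_zero]
    exact mul_mapMat_block_eq_zero hξ hp fun d hd =>
      projProd_mul_eq_zero hli hh a.1 a.2 d (by have := Fin.lt_def.1 hb; omega)
  have hc0 : C' * ξ c p = -(phi h ξ a p * B a c p) := by
    rw [h4 c hca, hξ.deriv_eq c p hp, Matrix.mul_sum, Finset.sum_eq_single a]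
    · rw [phi, Matrix.mul_assoc]
    · intro d hd hda
      rw [← Matrix.mul_assoc, projProd_mul_eq_zero hli hh a.1 a.2 d, Matrix.zero_mul]
      have h5 := (Finset.mem_filter.1 hd).2
      have h6 : d.1 ≠ a.1 := fun h => hda (Fin.ext h)
      omega
    · intro h
      exact absurd (Finset.mem_filter.2 ⟨Finset.mem_univ a, by omega⟩) h
  have hPa : projProd h (fun b => ξ b p) a.1 a.2 = projProd h (fun b => ξ b p) c.1 c.2 -
      phi h ξ c p * (beta h ξ c p)⁻¹ * (phi h ξ c p)ᴴ * h := by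
    obtain ⟨a, ha⟩ := a
    subst hac
    exact hOc.orthProj_mul
  have hC' : C' = -(phi h ξ a p * B a c p) * (beta h ξ c p)⁻¹ * (phi h ξ c p)ᴴ * h := by
    rw [hPa, Matrix.mul_sub, mul_projProd c.1 c.2 fun b hb => hb0 b hb, sub_eq_zero] at h2
    refine h2.trans ?_
    simp only [← Matrix.mul_assoc]
    rw [mul_phi hb0, hc0]
  have hβ : (phi h ξ a p)ᴴ * h * ξ a p = beta h ξ a p := hOa.gram_eq
  have h5 : h * D = h * (phi h ξ c p * ((beta h ξ c p)⁻¹ * (-(B a c p)ᴴ) * beta h ξ a p)) := by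
    have h6 : ((beta h ξ c p)⁻¹)ᴴ = (beta h ξ c p)⁻¹ := conjTranspose_gram_inv hh.1 _
    rw [hD, ← Matrix.mul_assoc, h3, hC', ← hβ]
    simp only [Matrix.conjTranspose_mul, Matrix.conjTranspose_neg, h6, hh.1.eq,
      Matrix.conjTranspose_conjTranspose, Matrix.mul_assoc, Matrix.neg_mul, Matrix.mul_neg]
  have := congrArg (h⁻¹ * ·) h5
  simpa only [← Matrix.mul_assoc, Matrix.nonsing_inv_mul _ hu, Matrix.one_mul] using this

/-- `φ_0 = ξ_0` is holomorphic. -/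
theorem frenet_plus_zero {C D : Matrix (Fin n) (Fin (κ 0)) ℂ}
    (hφ : HasMatrixWirtinger (fun y => phi h ξ 0 (z.symm y)) C D (z p)) : D = 0 := by
  have h1 : HasMatrixWirtinger (fun y => projProd h (fun b => ξ b (z.symm y))
      (0 : Fin (t + 1)).1 (0 : Fin (t + 1)).2) 0 0 (z p) := HasMatrixWirtinger.const 1
  rw [(wirtinger_phi hh hξ hp 0 h1 hφ).2, Matrix.zero_mul]

omit hh hξ hp [TopologicalSpace M] in
theorem frame_mul_apply {S : Type*} (L : Matrix (BlockIdx κ) S ℂ) (i : Fin n) (s : S) :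
    (frame h ξ p * L) i s =
      ∑ b, (phi h ξ b p * Matrix.of fun l s => L ⟨b, l⟩ s) i s := by
  rw [Matrix.mul_apply, Fintype.sum_sigma]
  rfl

/-- The Frenet frame is differentiable, with the derivatives given by the Frenet equations. -/
theorem hasMatrixWirtinger_frame : HasMatrixWirtinger (fun y => frame h ξ (z.symm y))
    (frame h ξ p * lamMinus h ξ z B p) (frame h ξ p * lamPlus h ξ B p) (z p) := by
  rintro i ⟨a, j⟩
  obtain ⟨C, D, hφ⟩ := exists_hasMatrixWirtinger_phi hh hξ hp a
  have h1 : C i j = (frame h ξ p * lamMinus h ξ z B p) i ⟨a, j⟩ := by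
    rw [frenet_minus hh hξ hp a hφ, lamMinus, Matrix.mul_add, Matrix.add_apply, Matrix.add_apply]
    congr 1
    · rw [frame_mul_apply, Finset.sum_eq_single a]
      · simp only [Matrix.blockDiagonal'_apply_eq, Matrix.mul_apply, Matrix.of_apply]
      · intro b _ hb
        simp only [Matrix.mul_apply, Matrix.of_apply]
        refine Finset.sum_eq_zero fun l _ => ?_
        rw [Matrix.blockDiagonal'_apply_ne _ _ _ hb, mul_zero]
      · exact fun h => absurd (Finset.mem_univ a) h
    · rw [frame_mul_apply, Matrix.sum_apply]
      refine Finset.sum_congr rfl fun b _ => ?_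
      split_ifs with hb
      · simp [Matrix.mul_apply, hb]
      · simp [Matrix.mul_apply, hb]
  have h2 : D i j = (frame h ξ p * lamPlus h ξ B p) i ⟨a, j⟩ := by
    rw [frame_mul_apply]
    rcases Nat.eq_zero_or_eq_succ_pred a.1 with ha | ha
    · obtain rfl : a = 0 := Fin.ext ha
      rw [frenet_plus_zero hh hξ hp hφ]
      symm
      refine Finset.sum_eq_zero fun b _ => ?_
      simp [Matrix.mul_apply, lamPlus]
    · have hc : a.1.pred < t + 1 := by omega
      rw [Finset.sum_eq_single ⟨a.1.pred, hc⟩,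
        frenet_plus_succ hh hξ hp a ⟨a.1.pred, hc⟩ ha.symm hφ]
      · rw [Matrix.mul_apply, Matrix.mul_apply]
        refine Finset.sum_congr rfl fun l _ => ?_
        rw [Matrix.of_apply, lamPlus, Matrix.of_apply, if_pos ha.symm]
      · intro b _ hb
        rw [Matrix.mul_apply]
        refine Finset.sum_eq_zero fun l _ => ?_
        rw [Matrix.of_apply, lamPlus, Matrix.of_apply, if_neg, mul_zero]
        intro h
        exact hb (Fin.ext (by simp only at h ⊢; omega))
      · exact fun h => absurd (Finset.mem_univ _) h
  rw [← h1, ← h2]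
  exact hφ i j

end FrenetEquations

/-! ### Linear fullness: the Frenet frame spans `ℂ^n` -/

section Fullness

/-- A solution on an open set of a holomorphic system of linear differential equations that
vanishes at a point vanishes near this point. -/
theorem eventually_eq_zero_of_linear_ode {ι : Type*} [Fintype ι] {U : Set ℂ} (hU : IsOpen U)
    {x₀ : ℂ} (hx₀ : x₀ ∈ U) {G : ℂ → ι → ℂ} {N : ℂ → Matrix ι ι ℂ}
    (hN : ∀ i j, ContinuousOn (fun x => N x i j) U)
    (hG : ∀ x ∈ U, HasDerivAt G (G x ᵥ* N x) x) (h0 : G x₀ = 0) :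
    ∀ᶠ x in nhds x₀, G x = 0 := by
  obtain ⟨r, hr, hrU⟩ := Metric.nhds_basis_closedBall.mem_iff.1 (hU.mem_nhds hx₀)
  have hbound : ∀ i j, ∃ C, ∀ x ∈ Metric.closedBall x₀ r, ‖N x i j‖ ≤ C := fun i j =>
    (isCompact_closedBall x₀ r).exists_bound_of_continuousOn ((hN i j).mono hrU)
  choose C hC using hbound
  filter_upwards [Metric.closedBall_mem_nhds x₀ hr] with x hx
  -- restrict the equation to the segment from `x₀` to `x`
  have hseg : ∀ s ∈ Set.Icc (0 : ℝ) 1, x₀ + (s : ℂ) * (x - x₀) ∈ Metric.closedBall x₀ r := by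
    intro s hs
    rw [mem_closedBall_iff_norm] at hx ⊢
    rw [add_sub_cancel_left, norm_mul, Complex.norm_real, Real.norm_of_nonneg hs.1]
    exact (mul_le_of_le_one_left (norm_nonneg _) hs.2).trans hx
  have hd : ∀ s ∈ Set.Icc (0 : ℝ) 1, HasDerivAt (fun s : ℝ => G (x₀ + (s : ℂ) * (x - x₀)))
      ((x - x₀) • (G (x₀ + (s : ℂ) * (x - x₀)) ᵥ* N (x₀ + (s : ℂ) * (x - x₀)))) s := by
    intro s hs
    have h1 : HasDerivAt (fun s : ℝ => x₀ + (s : ℂ) * (x - x₀)) (x - x₀) s := by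
      simpa using ((Complex.ofRealCLM.hasDerivAt (x := s)).mul_const (x - x₀)).const_add x₀
    exact (hG _ (hrU (hseg s hs))).scomp s h1
  have key := eq_zero_of_abs_deriv_le_mul_abs_self_of_eq_zero_right
    (f := fun s : ℝ => G (x₀ + (s : ℂ) * (x - x₀))) (a := 0) (b := 1)
    (K := ‖x - x₀‖ * ∑ i, ∑ j, |C i j|)
    (fun s hs => (hd s hs).continuousAt.continuousWithinAt)
    (fun s hs => (hd s (Set.Ico_subset_Icc_self hs)).hasDerivWithinAt)
    (by simpa using h0) (fun s hs => by
      rw [norm_smul, mul_assoc]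
      refine mul_le_mul_of_nonneg_left ?_ (norm_nonneg _)
      have hs' := hseg s (Set.Ico_subset_Icc_self hs)
      rw [pi_norm_le_iff_of_nonneg (by positivity)]
      intro j
      rw [Matrix.vecMul, dotProduct, Finset.sum_mul]
      refine (norm_sum_le _ _).trans (Finset.sum_le_sum fun i _ => ?_)
      rw [norm_mul, mul_comm]
      refine mul_le_mul ?_ (norm_le_pi_norm _ i) (norm_nonneg _) (by positivity)
      exact ((hC i j _ hs').trans (le_abs_self _)).trans
        (Finset.single_le_sum (f := fun j => |C i j|) (fun _ _ => abs_nonneg _)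
          (Finset.mem_univ j)))
  simpa using key 1 (by simp)

variable {n k : ℕ}

theorem Gr.space_proj_le_iff (w : FullRank n k) (u : Fin n → ℂ) :
    (Gr.proj w).space ≤ LinearMap.ker (dotProductBilin ℂ ℂ u) ↔ u ᵥ* w.1 = 0 := by
  have h1 : (Gr.proj w).space = LinearMap.range w.1.mulVecLin := rfl
  rw [h1, LinearMap.range_le_iff_comap, Submodule.eq_top_iff']
  simp only [Submodule.mem_comap, LinearMap.mem_ker, Matrix.mulVecLin_apply]
  change (∀ v, u ⬝ᵥ (w.1 *ᵥ v) = 0) ↔ _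
  simp only [Matrix.dotProduct_mulVec]
  exact ⟨fun h => dotProduct_eq_zero _ h, fun h v => by rw [h, zero_dotProduct]⟩

theorem AffineChart.proj_sect_coord (c : AffineChart n k) {x : Gr n k} (hx : x ∈ c.domain) :
    Gr.proj ⟨c.sect (c.coord x), c.rank_sect _⟩ = x :=
  c.toChart.left_inv hx

/-- The identity theorem for a holomorphic curve in the Grassmann manifold: the set of points
near which the curve lies in the hyperplane `u ⬝ v = 0` is closed. -/
theorem isClosed_setOf_eventually_space_le {M : Type*} [TopologicalSpace M] [ChartedSpace ℂ M]
    [IsManifold 𝓘(ℂ) 1 M] {ψ : M → Gr n k}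
    (hψ : MDifferentiable 𝓘(ℂ) 𝓘(ℂ, Fin (n - k) → Fin k → ℂ) ψ) (u : Fin n → ℂ) :
    IsClosed {q : M | ∀ᶠ q' in nhds q,
      (ψ q').space ≤ LinearMap.ker (dotProductBilin ℂ ℂ u)} := by
  refine isClosed_of_closure_subset fun q₀ hq₀ => ?_
  have hcont : Continuous ψ := hψ.continuous
  set e := chartAt ℂ q₀ with he
  obtain ⟨c, hc⟩ : ∃ c : AffineChart n k,
      c.toChart = chartAt (Fin (n - k) → Fin k → ℂ) (ψ q₀) :=
    ⟨(AffineChart.exists_mem_domain (ψ q₀)).choose, rfl⟩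
  have hc0 : ψ q₀ ∈ c.domain := by
    have := mem_chart_source (Fin (n - k) → Fin k → ℂ) (ψ q₀)
    rwa [← hc] at this
  have hO : e.target ∩ e.symm ⁻¹' (ψ ⁻¹' c.domain) ∈ nhds (e q₀) := by
    refine Filter.inter_mem (e.open_target.mem_nhds (mem_chart_target ℂ q₀)) ?_
    refine (e.continuousAt_symm (mem_chart_target ℂ q₀)).preimage_mem_nhds ?_
    rw [he, (chartAt ℂ q₀).left_inv (mem_chart_source ℂ q₀)]
    exact (c.isOpen_domain.preimage hcont).mem_nhds hc0
  obtain ⟨r, hr, hrO⟩ := Metric.nhds_basis_ball.mem_iff.1 hO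
  -- in charts around `q₀` and `ψ q₀`, the curve lies in the hyperplane where `H` vanishes
  let Z : ℂ → Matrix (Fin (n - k)) (Fin k) ℂ := fun ζ => c.coord (ψ (e.symm ζ))
  let H : ℂ → Fin k → ℂ := fun ζ => u ᵥ* c.sect (Z ζ)
  have hH : ∀ ζ ∈ Metric.ball (e q₀) r, H ζ = 0 ↔
      (ψ (e.symm ζ)).space ≤ LinearMap.ker (dotProductBilin ℂ ℂ u) := by
    intro ζ hζ
    have h1 := Gr.space_proj_le_iff ⟨c.sect (Z ζ), c.rank_sect _⟩ u
    rw [c.proj_sect_coord (hrO hζ).2] at h1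
    exact h1.symm
  have hZ : ∀ i j, DifferentiableOn ℂ (fun ζ => Z ζ i j) (Metric.ball (e q₀) r) := by
    intro i j ζ hζ
    have h1 := (hrO hζ).1
    have h2 := (mdifferentiableAt_iff_of_mem_source (x := q₀) (y := ψ q₀)
      (e.map_target h1) (by rw [← hc]; exact (hrO hζ).2)).1 (hψ (e.symm ζ))
    have h3 : DifferentiableAt ℂ
        (chartAt (Fin (n - k) → Fin k → ℂ) (ψ q₀) ∘ ψ ∘ e.symm) ζ := by
      have := h2.2
      simpa [mfld_simps, ← he, e.right_inv h1, differentiableWithinAt_univ] using this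
    rw [← hc] at h3
    exact (differentiableAt_pi.1 (differentiableAt_pi.1 h3 i) j).differentiableWithinAt
  have hHd : DifferentiableOn ℂ H (Metric.ball (e q₀) r) := by
    refine differentiableOn_pi.2 fun j => ?_
    simp only [H, Matrix.vecMul, dotProduct, AffineChart.sect, Matrix.add_apply, Matrix.mul_apply]
    refine DifferentiableOn.fun_sum fun i _ => DifferentiableOn.const_mul ?_ _
    refine DifferentiableOn.const_add _ ?_
    exact DifferentiableOn.fun_sum fun l _ => (hZ l j).const_mul _
  have hq0s : q₀ ∈ e.source := mem_chart_source ℂ q₀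
  have hnhds : e.source ∩ e ⁻¹' Metric.ball (e q₀) r ∈ nhds q₀ :=
    Filter.inter_mem (e.open_source.mem_nhds hq0s)
      ((e.continuousAt hq0s).preimage_mem_nhds (Metric.ball_mem_nhds _ hr))
  obtain ⟨q₁, ⟨hq₁s, hq₁b⟩, hq₁⟩ := mem_closure_iff_nhds.1 hq₀ _ hnhds
  have hev : H =ᶠ[nhds (e q₁)] 0 := by
    have h1 : Filter.Tendsto e.symm (nhds (e q₁)) (nhds q₁) := by
      have := e.continuousAt_symm (e.map_source hq₁s)
      rwa [ContinuousAt, e.left_inv hq₁s] at this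
    filter_upwards [h1.eventually hq₁, Metric.isOpen_ball.mem_nhds hq₁b] with ζ h2 h3
    exact (hH ζ h3).2 h2
  have hzero := AnalyticOnNhd.eqOn_zero_of_preconnected_of_eventuallyEq_zero
    (hHd.analyticOnNhd Metric.isOpen_ball) (convex_ball _ _).isPreconnected hq₁b hev
  filter_upwards [hnhds] with q hq
  have := (hH (e q) hq.2).1 (hzero hq.2)
  rwa [e.left_inv hq.1] at this

/-- The Frenet frame of a linearly full curve has `n` columns. If it had fewer, a functional
`u ≠ 0` would vanish on all blocks at a point, hence near this point (uniqueness for the linear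
equations `∂_- ξ = ξ B`), and the whole curve would lie in the hyperplane `u ⬝ v = 0` by the
identity theorem. -/
theorem card_blockIdx_eq {M : Type*} [TopologicalSpace M] [ChartedSpace ℂ M]
    [IsManifold 𝓘(ℂ) 1 M] [ConnectedSpace M] {t : ℕ} {κ : Fin (t + 1) → ℕ}
    {ψ : M → Gr n (κ 0)}
    (hψ : MDifferentiable 𝓘(ℂ) 𝓘(ℂ, Fin (n - κ 0) → Fin (κ 0) → ℂ) ψ)
    (hfull : LinearlyFull ψ) {z : OpenPartialHomeomorph M ℂ}
    {ξ : (a : Fin (t + 1)) → M → Matrix (Fin n) (Fin (κ a)) ℂ}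
    (hlift : IsHolomorphicLift z ψ (ξ 0))
    {B : (b a : Fin (t + 1)) → M → Matrix (Fin (κ b)) (Fin (κ a)) ℂ}
    (hξ : IsOsculatingSequence z ξ B) {p : M} (hp : p ∈ z.source) :
    Fintype.card (BlockIdx κ) = n := by
  refine le_antisymm ?_ (not_lt.1 fun hlt => ?_)
  · simpa using (hξ.linearIndependent p hp).fintype_card_le_finrank
  let X : M → Matrix (Fin n) (BlockIdx κ) ℂ := fun q => Matrix.of fun i x => ξ x.1 q i x.2
  obtain ⟨u, hu, hu0⟩ : ∃ u : Fin n → ℂ, u ᵥ* X p = 0 ∧ u ≠ 0 := by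
    have h1 : LinearMap.ker (X p).vecMulLinear ≠ ⊥ :=
      LinearMap.ker_ne_bot_of_finrank_lt (by simpa using hlt)
    obtain ⟨u, hu, hu0⟩ := (Submodule.ne_bot_iff _).1 h1
    exact ⟨u, hu, hu0⟩
  -- the equations `∂_- ξ_a = ∑ ξ_b B_{ba}` for all blocks at once, as `X' = X N`
  let N : M → Matrix (BlockIdx κ) (BlockIdx κ) ℂ := fun q =>
    Matrix.of fun y x => if y.1.val ≤ x.1.val + 1 then B y.1 x.1 q y.2 x.2 else 0
  have hX : ∀ q ∈ z.source, ∀ i x, HasDerivAt (fun ζ => X (z.symm ζ) i x) ((X q * N q) i x)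
      (z q) := by
    rintro q hq i ⟨a, j⟩
    have hd : DifferentiableAt ℂ (fun ζ => X (z.symm ζ) i ⟨a, j⟩) (z q) :=
      (hξ.holomorphic a i j).differentiableAt (z.open_target.mem_nhds (z.map_source hq))
    refine hd.hasDerivAt.congr_deriv ?_
    have h1 : mapMat (dMinus z) (ξ a) q i j = deriv (fun ζ => X (z.symm ζ) i ⟨a, j⟩) (z q) :=
      (HasWirtinger.of_hasDerivAt hd.hasDerivAt).dHol_eq
    rw [← h1, hξ.deriv_eq a q hq, Matrix.mul_apply, Fintype.sum_sigma, Finset.sum_filter,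
      Matrix.sum_apply]
    refine Finset.sum_congr rfl fun b _ => ?_
    by_cases hb : b.1 ≤ a.1 + 1
    · simp [X, N, hb, Matrix.mul_apply]
    · simp [X, N, hb]
  have hode := eventually_eq_zero_of_linear_ode z.open_target (z.map_source hp)
    (G := fun ζ => u ᵥ* X (z.symm ζ)) (N := fun ζ => N (z.symm ζ)) (fun y x => by
      by_cases hb : y.1.val ≤ x.1.val + 1
      · simp only [N, Matrix.of_apply, if_pos hb]
        exact (hξ.holomorphic_coeff y.1 x.1 y.2 x.2).continuousOn
      · simp only [N, Matrix.of_apply, if_neg hb]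
        exact continuousOn_const) (fun ζ hζ => by
      rw [hasDerivAt_pi]
      intro x
      rw [Matrix.vecMul_vecMul]
      have h1 := fun i => (hX (z.symm ζ) (z.map_target hζ) i x).const_mul (u i)
      rw [z.right_inv hζ] at h1
      simp only [Matrix.vecMul, dotProduct]
      exact HasDerivAt.fun_sum fun i _ => h1 i) (by rw [z.left_inv hp]; exact hu)
  have hnear : ∀ᶠ q in nhds p, (ψ q).space ≤ LinearMap.ker (dotProductBilin ℂ ℂ u) := by
    filter_upwards [(z.continuousAt hp).eventually hode, z.open_source.mem_nhds hp] with q h1 h2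
    obtain ⟨hr, hq⟩ := hlift.2 q h2
    rw [← hq, Gr.space_proj_le_iff]
    rw [z.left_inv h2] at h1
    funext j
    exact congrFun h1 ⟨0, j⟩
  have hclopen : IsClopen {q : M | ∀ᶠ q' in nhds q,
      (ψ q').space ≤ LinearMap.ker (dotProductBilin ℂ ℂ u)} :=
    ⟨isClosed_setOf_eventually_space_le hψ u, isOpen_setOfPred_eventually_nhds⟩
  have huniv := hclopen.eq_univ ⟨p, hnear⟩
  have htop := hfull (LinearMap.ker (dotProductBilin ℂ ℂ u)) fun q => by
    have : q ∈ {q : M | ∀ᶠ q' in nhds q,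
      (ψ q').space ≤ LinearMap.ker (dotProductBilin ℂ ℂ u)} := huniv ▸ Set.mem_univ q
    exact this.self_of_nhds
  refine hu0 (dotProduct_eq_zero u fun v => ?_)
  have : v ∈ LinearMap.ker (dotProductBilin ℂ ℂ u) := htop ▸ Submodule.mem_top
  exact this

end Fullness

/-! ### Affine charts and the moving frame -/

section Charts

/-- The vector of type `(1, 0)` with the given matrix of components. -/
def ofHol (r s : ℕ) : Matrix (Fin r) (Fin s) ℂ →ₗ[ℂ] (CIdx r s → ℂ) where
  toFun V := Sum.elim (fun q => V q.1 q.2) 0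
  map_add' V W := by
    ext (q | q) <;> simp
  map_smul' a V := by
    ext (q | q) <;> simp

@[simp]
theorem ofHol_inl {r s : ℕ} (V : Matrix (Fin r) (Fin s) ℂ) (q : Fin r × Fin s) :
    ofHol r s V (Sum.inl q) = V q.1 q.2 := rfl

@[simp]
theorem ofHol_inr {r s : ℕ} (V : Matrix (Fin r) (Fin s) ℂ) (q : Fin r × Fin s) :
    ofHol r s V (Sum.inr q) = 0 := rfl

theorem ofHol_injective (r s : ℕ) : Function.Injective (ofHol r s) := fun _ _ h =>
  Matrix.ext fun i j => congrFun h (Sum.inl (i, j))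

theorem range_ofHol (r s : ℕ) : LinearMap.range (ofHol r s) = holVectors r s := by
  ext X
  constructor
  · rintro ⟨V, rfl⟩ q
    rfl
  · intro hX
    refine ⟨hol X, ?_⟩
    ext (q | q)
    · rfl
    · exact (hX q).symm

theorem mul_single_mul_apply {R R' S S' : Type*} [Fintype R] [Fintype S] [DecidableEq R]
    [DecidableEq S] (U : Matrix R' R ℂ) (V : Matrix S S' ℂ) (a : R) (b : S) (i : R') (j : S') :
    (U * Matrix.single a b (1 : ℂ) * V) i j = U i a * V b j := by
  rw [Matrix.mul_apply, Finset.sum_eq_single b]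
  · simp
  · intro d _ hd
    rw [Matrix.mul_single_apply_of_ne (hbj := hd), zero_mul]
  · exact fun h => absurd (Finset.mem_univ b) h

theorem mul_mul_apply_eq_sum {R R' S S' : Type*} [Fintype R] [Fintype S]
    (U : Matrix R' R ℂ) (W : Matrix R S ℂ) (V : Matrix S S' ℂ) (i : R') (j : S') :
    (U * W * V) i j = ∑ q : R × S, W q.1 q.2 * (U i q.1 * V q.2 j) := by
  rw [Matrix.mul_apply, Fintype.sum_prod_type_right]
  refine Finset.sum_congr rfl fun b _ => ?_
  rw [Matrix.mul_apply, Finset.sum_mul]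
  exact Finset.sum_congr rfl fun a _ => by ring

/-- The differential of a holomorphic map `F` with complex differential `E ↦ U E V` at `w`. -/
theorem push_eq {r s r' s' : ℕ} {F : Matrix (Fin r) (Fin s) ℂ → Matrix (Fin r') (Fin s') ℂ}
    {w : Matrix (Fin r) (Fin s) ℂ} {U : Matrix (Fin r') (Fin r) ℂ} {V : Matrix (Fin s) (Fin s') ℂ}
    (hF : ∀ q : Fin r × Fin s, HasMatrixWirtinger
      (fun ζ => F (w + ζ • Matrix.single q.1 q.2 (1 : ℂ)))
      (U * Matrix.single q.1 q.2 (1 : ℂ) * V) 0 0) (X : CIdx r s → ℂ) :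
    hol (push F w X) = U * hol X * V ∧
      bar (push F w X) = U.map star * bar X * V.map star := by
  have h1 : ∀ (A : Fin r' × Fin s') (q : Fin r × Fin s),
      coordDeriv (fun w' => coordFn (F w') (Sum.inl A)) w (Sum.inl q) = U A.1 q.1 * V q.2 A.2 ∧
      coordDeriv (fun w' => coordFn (F w') (Sum.inl A)) w (Sum.inr q) = 0 := by
    intro A q
    have := hF q A.1 A.2
    rw [mul_single_mul_apply] at this
    exact ⟨coordDeriv_inl_eq this, coordDeriv_inr_eq this⟩
  have h2 : ∀ (A : Fin r' × Fin s') (q : Fin r × Fin s),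
      coordDeriv (fun w' => coordFn (F w') (Sum.inr A)) w (Sum.inl q) = 0 ∧
      coordDeriv (fun w' => coordFn (F w') (Sum.inr A)) w (Sum.inr q) =
        star (U A.1 q.1) * star (V q.2 A.2) := by
    intro A q
    have := (hF q A.1 A.2).star
    rw [mul_single_mul_apply, Matrix.zero_apply, star_zero, star_mul'] at this
    exact ⟨coordDeriv_inl_eq this, coordDeriv_inr_eq this⟩
  constructor
  · ext i j
    rw [mul_mul_apply_eq_sum]
    change push F w X (Sum.inl (i, j)) = _
    simp [push, Fintype.sum_sum_type, h1, hol]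
  · ext i j
    rw [mul_mul_apply_eq_sum]
    change push F w X (Sum.inr (i, j)) = _
    simp [push, Fintype.sum_sum_type, h2, bar]

variable {n k : ℕ} (c : AffineChart n k)

namespace AffineChart

/-- The left factor `C - Z A` of the differential `V ↦ (C - Z A) V (A w)⁻¹` of the affine
coordinates at `w`, where `Z` are the affine coordinates of `w`. -/
noncomputable def diffLeft (w : Matrix (Fin n) (Fin k) ℂ) : Matrix (Fin (n - k)) (Fin n) ℂ :=
  c.C - c.coordFun w * c.A

theorem hasMatrixWirtinger_coordFun {F : ℂ → Matrix (Fin n) (Fin k) ℂ}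
    {V W : Matrix (Fin n) (Fin k) ℂ} {x : ℂ} (hF : HasMatrixWirtinger F V W x)
    (hu : IsUnit (c.A * F x).det) :
    HasMatrixWirtinger (fun y => c.coordFun (F y)) (c.diffLeft (F x) * V * (c.A * F x)⁻¹)
      (c.diffLeft (F x) * W * (c.A * F x)⁻¹) x := by
  have h1 := (hF.const_mul c.C).mul ((hF.const_mul c.A).inv hu)
  have h2 : ∀ V : Matrix (Fin n) (Fin k) ℂ, c.C * V * (c.A * F x)⁻¹ +
      c.C * F x * -((c.A * F x)⁻¹ * (c.A * V) * (c.A * F x)⁻¹) =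
        c.diffLeft (F x) * V * (c.A * F x)⁻¹ := by
    intro V
    simp only [diffLeft, coordFun, Matrix.sub_mul, Matrix.mul_neg, Matrix.mul_assoc,
      ← sub_eq_add_neg]
  rw [h2, h2] at h1
  exact h1

theorem diffLeft_mul_self {w : Matrix (Fin n) (Fin k) ℂ} (hu : IsUnit (c.A * w).det) :
    c.diffLeft w * w = 0 := by
  rw [diffLeft, coordFun, Matrix.sub_mul, sub_eq_zero, Matrix.mul_assoc _ c.A, Matrix.mul_assoc,
    Matrix.nonsing_inv_mul _ hu, Matrix.mul_one]

theorem diffLeft_mul_Q (w : Matrix (Fin n) (Fin k) ℂ) : c.diffLeft w * c.Q = 1 := by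
  rw [diffLeft, Matrix.sub_mul, c.CQ, Matrix.mul_assoc, c.AQ, Matrix.mul_zero, sub_zero]

/-- `Q (C - Z A)` is the projection along `w` onto the range of `Q`. -/
theorem Q_mul_diffLeft {w : Matrix (Fin n) (Fin k) ℂ} (hu : IsUnit (c.A * w).det) :
    c.Q * c.diffLeft w = 1 - w * (c.A * w)⁻¹ * c.A := by
  rw [← c.sect_coordFun w ((Matrix.isUnit_iff_isUnit_det _).2 hu), sect, diffLeft, ← c.sum_eq,
    Matrix.mul_sub, Matrix.add_mul, Matrix.mul_assoc]
  abel

theorem hol_push_sect (Z : Matrix (Fin (n - k)) (Fin k) ℂ) (X : CIdx (n - k) k → ℂ) :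
    hol (push c.sect Z X) = c.Q * hol X ∧ bar (push c.sect Z X) = c.Q.map star * bar X := by
  have h1 : ∀ q : Fin (n - k) × Fin k, HasMatrixWirtinger
      (fun ζ => c.sect (Z + ζ • Matrix.single q.1 q.2 (1 : ℂ)))
      (c.Q * Matrix.single q.1 q.2 (1 : ℂ) * (1 : Matrix (Fin k) (Fin k) ℂ)) 0 0 := by
    intro q
    have := (HasMatrixWirtinger.const (x := 0) c.P).add
      ((HasMatrixWirtinger.slice Z (Matrix.single q.1 q.2 (1 : ℂ))).const_mul c.Q)
    rw [Matrix.mul_one]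
    rw [zero_add, Matrix.mul_zero, zero_add] at this
    exact this
  have h2 := push_eq h1 X
  rwa [Matrix.mul_one, Matrix.map_one _ (star_zero _) (star_one _), Matrix.mul_one] at h2

theorem push_coordFun {w : Matrix (Fin n) (Fin k) ℂ} (hu : IsUnit (c.A * w).det)
    {X : CIdx n k → ℂ} (hX : bar X = 0) :
    push c.coordFun w X = ofHol _ _ (c.diffLeft w * hol X * (c.A * w)⁻¹) := by
  have h1 := push_eq (F := c.coordFun) (w := w) (U := c.diffLeft w) (V := (c.A * w)⁻¹)
    (fun q => by
      have := c.hasMatrixWirtinger_coordFun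
        (HasMatrixWirtinger.slice (x := 0) w (Matrix.single q.1 q.2 (1 : ℂ))) (by simpa using hu)
      simpa only [zero_smul, add_zero, Matrix.mul_zero, Matrix.zero_mul] using this) X
  rw [hX, Matrix.mul_zero, Matrix.zero_mul] at h1
  ext (q | q)
  · exact congrFun (congrFun h1.1 q.1) q.2
  · exact congrFun (congrFun h1.2 q.1) q.2

end AffineChart

variable {M : Type*} {t : ℕ} {κ : Fin (t + 1) → ℕ} {h : Matrix (Fin n) (Fin n) ℂ}
  {ξ : (a : Fin (t + 1)) → M → Matrix (Fin n) (Fin (κ a)) ℂ} {p : M}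

theorem phi_zero : phi h ξ 0 p = ξ 0 p := Matrix.one_mul _

theorem frame_apply_zero (i : Fin n) (j : Fin (κ 0)) : frame h ξ p i ⟨0, j⟩ = ξ 0 p i j :=
  congrFun (congrFun phi_zero i) j

/-- The horizontal columns of the Frenet frame, expressed in an affine chart up to the right
factor `(A ξ_0)⁻¹`. -/
noncomputable def horFrame (h : Matrix (Fin n) (Fin n) ℂ)
    (ξ : (a : Fin (t + 1)) → M → Matrix (Fin n) (Fin (κ a)) ℂ) (c : AffineChart n (κ 0)) (p : M) :
    Matrix (Fin (n - κ 0)) (HorIdx κ) ℂ :=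
  c.diffLeft (ξ 0 p) * (frame h ξ p).submatrix id Subtype.val

theorem movingE_eq (c : AffineChart n (κ 0)) (hu : IsUnit (c.A * ξ 0 p).det) (μ : HorIdx κ)
    (α : Fin (κ 0)) : movingE h ξ c μ α p =
      ofHol _ _ (horFrame h ξ c p * Matrix.single μ α (1 : ℂ) * (c.A * ξ 0 p)⁻¹) := by
  rw [movingE, c.push_coordFun hu rfl]
  congr 2
  rw [horFrame, Matrix.mul_assoc]
  congr 1
  refine Matrix.ext fun i β => ?_
  rw [← Matrix.mul_one (_ * Matrix.single μ α (1 : ℂ)), mul_single_mul_apply, Matrix.one_apply]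
  change (if β = α then frame h ξ p i μ.1 else 0) = _
  simp [eq_comm]

theorem sum_smul_movingE (c : AffineChart n (κ 0)) (hu : IsUnit (c.A * ξ 0 p).det)
    (W : Matrix (HorIdx κ) (Fin (κ 0)) ℂ) : ∑ ν, ∑ β, W ν β • movingE h ξ c ν β p =
      ofHol _ _ (horFrame h ξ c p * W * (c.A * ξ 0 p)⁻¹) := by
  simp only [movingE_eq c hu, ← map_smul, ← map_sum]
  congr 1
  conv_rhs => rw [Matrix.matrix_eq_sum_single W]
  simp only [Matrix.mul_sum, Matrix.sum_mul]
  refine Finset.sum_congr rfl fun ν _ => Finset.sum_congr rfl fun β _ => ?_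
  rw [← Matrix.smul_mul, ← Matrix.mul_smul, Matrix.smul_single, smul_eq_mul, mul_one]

/-- The columns of the Frenet frame are linearly independent: its blocks are injective and
pairwise `h`-orthogonal. -/
theorem frame_mulVec_injective (hh : h.PosDef)
    (hξ : LinearIndependent ℂ fun (x : BlockIdx κ) (i : Fin n) => ξ x.1 p i x.2) :
    Function.Injective (frame h ξ p).mulVec := by
  refine (injective_iff_map_eq_zero (frame h ξ p).mulVecLin).2 fun v hv => ?_
  have h1 : ∑ b, phi h ξ b p *ᵥ (fun j => v ⟨b, j⟩) = 0 := by
    rw [← hv]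
    ext i
    rw [Matrix.mulVecLin_apply, Matrix.mulVec, dotProduct, Fintype.sum_sigma, Finset.sum_apply]
    rfl
  funext x
  have h2 := congrArg (((phi h ξ x.1 p)ᴴ * h) *ᵥ ·) h1
  simp only [Matrix.mulVec_sum, Matrix.mulVec_mulVec, Matrix.mulVec_zero] at h2
  rw [Finset.sum_eq_single x.1] at h2
  · exact congrFun (Matrix.mulVec_injective_of_isUnit
      ((Matrix.isUnit_iff_isUnit_det _).2 (isUnit_det_beta hξ hh x.1))
      (h2.trans (Matrix.mulVec_zero _).symm)) x.2
  · intro b _ hb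
    rw [phi_orthogonal hξ hh hb.symm, Matrix.zero_mulVec]
  · exact fun h => absurd (Finset.mem_univ _) h

/-- The columns of `φ_0 = ξ_0` do not contribute, since `C - Z A` kills them. -/
theorem diffLeft_mul_frame_mul (c : AffineChart n (κ 0)) (hu : IsUnit (c.A * ξ 0 p).det)
    {S : Type*} (G : Matrix (BlockIdx κ) S ℂ) :
    c.diffLeft (ξ 0 p) * (frame h ξ p * G) =
      horFrame h ξ c p * (G.submatrix Subtype.val id : Matrix (HorIdx κ) S ℂ) := by
  have h1 : ∀ i j, (c.diffLeft (ξ 0 p) * frame h ξ p) i ⟨0, j⟩ = 0 := by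
    intro i j
    have := congrFun (congrFun (c.diffLeft_mul_self hu) i) j
    rw [Matrix.mul_apply, Matrix.zero_apply] at this
    rw [Matrix.mul_apply, ← this]
    exact Finset.sum_congr rfl fun l _ => by rw [frame_apply_zero]
  rw [← Matrix.mul_assoc]
  ext i j
  rw [Matrix.mul_apply, Matrix.mul_apply]
  refine (Finset.sum_subset (Finset.subset_univ
    (Finset.univ.filter fun x : BlockIdx κ => x.1 ≠ 0)) ?_).symm.trans ?_
  · rintro ⟨b, l⟩ - hx
    obtain rfl : b = 0 := by simpa using hx
    rw [h1, zero_mul]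
  · exact Finset.sum_subtype _ (p := fun x : BlockIdx κ => x.1 ≠ 0) (by simp)
      (fun x => (c.diffLeft (ξ 0 p) * frame h ξ p) i x * G x j)

/-- The horizontal frame is invertible if the Frenet frame has `n` columns. -/
theorem exists_inverse_horFrame (hh : h.PosDef)
    (hξ : LinearIndependent ℂ fun (x : BlockIdx κ) (i : Fin n) => ξ x.1 p i x.2)
    (hcard : Fintype.card (BlockIdx κ) = n) (c : AffineChart n (κ 0))
    (hu : IsUnit (c.A * ξ 0 p).det) :
    ∃ S : Matrix (HorIdx κ) (Fin (n - κ 0)) ℂ,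
      S * horFrame h ξ c p = 1 ∧ horFrame h ξ c p * S = 1 := by
  obtain ⟨L, hL⟩ := LinearMap.exists_leftInverse_of_injective (frame h ξ p).mulVecLin
    (LinearMap.ker_eq_bot.2 (frame_mulVec_injective hh hξ))
  obtain ⟨G, hGF⟩ : ∃ G : Matrix (BlockIdx κ) (Fin n) ℂ, G * frame h ξ p = 1 := by
    refine ⟨LinearMap.toMatrix' L, ?_⟩
    have := congrArg LinearMap.toMatrix' hL
    rwa [LinearMap.toMatrix'_comp, LinearMap.toMatrix'_id,
      show LinearMap.toMatrix' (frame h ξ p).mulVecLin = frame h ξ p from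
        LinearMap.toMatrix'_toLin' _] at this
  have hFG : frame h ξ p * G = 1 :=
    (Matrix.mul_eq_one_comm_of_card_eq _ _ _ (by rw [hcard, Fintype.card_fin])).1 hGF
  obtain ⟨G', hG'⟩ : ∃ G' : Matrix (HorIdx κ) (Fin n) ℂ, ∀ μ i, G' μ i = G μ.1 i :=
    ⟨Matrix.of fun μ i => G μ.1 i, fun _ _ => rfl⟩
  refine ⟨G' * c.Q, ?_, ?_⟩
  · have h1 : G' * ξ 0 p = 0 := by
      ext μ j
      have := congrFun (congrFun hGF μ.1) ⟨0, j⟩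
      rw [Matrix.mul_apply, Matrix.one_apply_ne] at this
      · rw [Matrix.mul_apply, Matrix.zero_apply, ← this]
        exact Finset.sum_congr rfl fun i _ => by rw [hG', frame_apply_zero]
      · intro h
        exact μ.2 (congrArg Sigma.fst h)
    rw [horFrame, Matrix.mul_assoc, ← Matrix.mul_assoc c.Q, c.Q_mul_diffLeft hu,
      ← Matrix.mul_assoc, Matrix.mul_sub, Matrix.mul_one, Matrix.mul_assoc (ξ 0 p),
      ← Matrix.mul_assoc _ (ξ 0 p), h1, Matrix.zero_mul, sub_zero]
    ext μ ν
    have := congrFun (congrFun hGF μ.1) ν.1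
    rw [Matrix.one_apply, Matrix.mul_apply] at this
    rw [Matrix.one_apply, Matrix.mul_apply]
    simpa only [Subtype.ext_iff, hG', Matrix.submatrix_apply, id_eq] using this
  · have h1 : G.submatrix Subtype.val id = G' := Matrix.ext fun μ i => (hG' μ i).symm
    have h2 := diffLeft_mul_frame_mul (h := h) (ξ := ξ) c hu G
    rw [h1, hFG, Matrix.mul_one] at h2
    rw [← Matrix.mul_assoc, ← h2, c.diffLeft_mul_Q]

end Charts

/-! ### The Levi-Civita connection in an affine chart -/

section LeviCivita

variable {n k : ℕ} {h : Matrix (Fin n) (Fin n) ℂ} (c : AffineChart n k)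
  (Z : Matrix (Fin (n - k)) (Fin k) ℂ)

namespace AffineChart

/-- The inverse of the Gram matrix `Δ = s† h s` of the local section `s`. -/
noncomputable def gramInv (h : Matrix (Fin n) (Fin n) ℂ) : Matrix (Fin k) (Fin k) ℂ :=
  ((c.sect Z)ᴴ * h * c.sect Z)⁻¹

/-- The Gram matrix of the horizontal components of the columns of `Q`. -/
noncomputable def horGram (h : Matrix (Fin n) (Fin n) ℂ) : Matrix (Fin (n - k)) (Fin (n - k)) ℂ :=
  c.Qᴴ * h * orthProj h (c.sect Z) * c.Q

/-- The matrix `Δ⁻¹ s† h Q`, which expresses the orthogonal projections of the columns of `Q` to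
the subspace spanned by the local section through the latter. -/
noncomputable def tangential (h : Matrix (Fin n) (Fin n) ℂ) : Matrix (Fin k) (Fin (n - k)) ℂ :=
  c.gramInv Z h * (c.sect Z)ᴴ * h * c.Q

variable {Z}

theorem isUnit_det_gram_sect (hh : h.PosDef) : IsUnit ((c.sect Z)ᴴ * h * c.sect Z).det :=
  isUnit_det_gram hh (mulVec_injective_of_left_inverse (c.A_mul_sect Z))

theorem isOrthProjection_sect (hh : h.PosDef) : IsOrthProjection h (orthProj h (c.sect Z)) := by
  have h1 : IsOrthProjection h (1 : Matrix (Fin n) (Fin n) ℂ) := ⟨by simp, by simp⟩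
  have := h1.step hh.1 (X := c.sect Z)
    (by rw [Matrix.one_mul]; exact c.isUnit_det_gram_sect hh)
  rwa [Matrix.one_mul, Matrix.mul_one] at this

theorem horGram_eq (hh : h.PosDef) : c.horGram Z h =
    (orthProj h (c.sect Z) * c.Q)ᴴ * h * (orthProj h (c.sect Z) * c.Q) := by
  rw [← Matrix.mul_assoc, (c.isOrthProjection_sect hh).adjoint_block_mul, horGram,
    Matrix.conjTranspose_mul, Matrix.mul_assoc _ _ h, ← (c.isOrthProjection_sect hh).selfAdjoint]
  simp only [Matrix.mul_assoc]

theorem isUnit_horGram (hh : h.PosDef) : IsUnit (c.horGram Z h) := by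
  rw [c.horGram_eq hh]
  refine (hh.conjTranspose_mul_mul_same ?_).isUnit
  -- the factor `C - Z A` kills the local section, hence is a left inverse of `Π Q`
  refine mulVec_injective_of_left_inverse (K := c.diffLeft (c.sect Z)) ?_
  have hA : IsUnit (c.A * c.sect Z).det := by rw [c.A_mul_sect]; simp
  rw [← Matrix.mul_assoc, mul_orthProj_of_mul_eq_zero (c.diffLeft_mul_self hA),
    c.diffLeft_mul_Q]

theorem conjTranspose_horGram (hh : h.PosDef) : (c.horGram Z h)ᴴ = c.horGram Z h := by
  rw [c.horGram_eq hh, conjTranspose_gram hh.1]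

theorem conjTranspose_gramInv (hh : h.PosDef) : (c.gramInv Z h)ᴴ = c.gramInv Z h :=
  conjTranspose_gram_inv hh.1 _

end AffineChart

theorem hol_single_inl {r s : ℕ} (q : Fin r × Fin s) :
    hol (Pi.single (Sum.inl q) 1) = Matrix.single q.1 q.2 (1 : ℂ) := by
  ext i j
  simp [hol, Matrix.single_apply, Pi.single_apply, Prod.ext_iff, eq_comm]

theorem bar_single_inr {r s : ℕ} (q : Fin r × Fin s) :
    bar (Pi.single (Sum.inr q) 1) = Matrix.single q.1 q.2 (1 : ℂ) := by
  ext i j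
  simp [bar, Matrix.single_apply, Pi.single_apply, Prod.ext_iff, eq_comm]

theorem bar_single_inl {r s : ℕ} (q : Fin r × Fin s) :
    bar (Pi.single (Sum.inl q) 1) = 0 := by
  ext i j
  simp [bar]

theorem hol_single_inr {r s : ℕ} (q : Fin r × Fin s) :
    hol (Pi.single (Sum.inr q) 1) = 0 := by
  ext i j
  simp [hol]

variable {Z}

/-- The metric is `tr (dZ† K dZ Δ⁻¹)`, symmetrized, with `K = horGram` and `Δ⁻¹ = gramInv`. -/
theorem metricMatrix_apply (hh : h.PosDef) (A D : CIdx (n - k) k) : metricMatrix h c Z A D =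
    ((bar (Pi.single A 1))ᵀ * c.horGram Z h * hol (Pi.single D 1) * c.gramInv Z h).trace +
    ((bar (Pi.single D 1))ᵀ * c.horGram Z h * hol (Pi.single A 1) * c.gramInv Z h).trace := by
  have key : ∀ X Y : CIdx (n - k) k → ℂ,
      (bar (perp h (c.sect Z) (push c.sect Z X)))ᵀ * h *
        hol (perp h (c.sect Z) (push c.sect Z Y)) = (bar X)ᵀ * c.horGram Z h * hol Y := by
    intro X Y
    have e1 : hol (perp h (c.sect Z) (push c.sect Z Y)) =
      orthProj h (c.sect Z) * hol (push c.sect Z Y) := rfl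
    have e2 : bar (perp h (c.sect Z) (push c.sect Z X)) =
      (orthProj h (c.sect Z)).map star * bar (push c.sect Z X) := rfl
    have e3 : ((orthProj h (c.sect Z)).map star)ᵀ = (orthProj h (c.sect Z))ᴴ := rfl
    have e4 : (c.Q.map star)ᵀ = c.Qᴴ := rfl
    rw [e1, e2, (c.hol_push_sect Z Y).1, (c.hol_push_sect Z X).2, c.horGram_eq hh,
      Matrix.transpose_mul, Matrix.transpose_mul, e3, e4, Matrix.conjTranspose_mul]
    simp only [Matrix.mul_assoc]
  rw [metricMatrix, Matrix.of_apply, gStar_eq_trace, key, key]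
  rfl

theorem trace_single_transpose (q r : Fin (n - k) × Fin k)
    (K : Matrix (Fin (n - k)) (Fin (n - k)) ℂ)
    (D : Matrix (Fin k) (Fin k) ℂ) :
    ((Matrix.single q.1 q.2 (1 : ℂ))ᵀ * K * Matrix.single r.1 r.2 (1 : ℂ) * D).trace =
      K q.1 r.1 * D r.2 q.2 := by
  rw [Matrix.mul_assoc, Matrix.mul_assoc, ← Matrix.mul_assoc K, Matrix.transpose_single,
    Matrix.trace_single_mul, mul_single_mul_apply, one_smul]

theorem metricMatrix_inr_inl (hh : h.PosDef) (q r : Fin (n - k) × Fin k) :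
    metricMatrix h c Z (Sum.inr q) (Sum.inl r) = c.horGram Z h q.1 r.1 * c.gramInv Z h r.2 q.2 := by
  rw [metricMatrix_apply c hh, bar_single_inr, hol_single_inl, trace_single_transpose,
    bar_single_inl]
  simp

theorem metricMatrix_inl_inr (hh : h.PosDef) (q r : Fin (n - k) × Fin k) :
    metricMatrix h c Z (Sum.inl q) (Sum.inr r) = c.horGram Z h r.1 q.1 * c.gramInv Z h q.2 r.2 := by
  rw [metricMatrix_apply c hh, bar_single_inr, hol_single_inl, trace_single_transpose,
    bar_single_inl]
  simp

theorem metricMatrix_inl_inl (hh : h.PosDef) (q r : Fin (n - k) × Fin k) :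
    metricMatrix h c Z (Sum.inl q) (Sum.inl r) = 0 := by
  rw [metricMatrix_apply c hh, bar_single_inl, bar_single_inl]
  simp

theorem metricMatrix_inr_inr (hh : h.PosDef) (q r : Fin (n - k) × Fin k) :
    metricMatrix h c Z (Sum.inr q) (Sum.inr r) = 0 := by
  rw [metricMatrix_apply c hh, hol_single_inr, hol_single_inr]
  simp

theorem metricMatrix_mulVec_inr (hh : h.PosDef) (X : CIdx (n - k) k → ℂ) (q : Fin (n - k) × Fin k) :
    (metricMatrix h c Z *ᵥ X) (Sum.inr q) = (c.horGram Z h * hol X * c.gramInv Z h) q.1 q.2 := by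
  rw [mul_mul_apply_eq_sum, Matrix.mulVec, dotProduct, Fintype.sum_sum_type]
  simp only [metricMatrix_inr_inl c hh, metricMatrix_inr_inr c hh, zero_mul,
    Finset.sum_const_zero, add_zero]
  exact Finset.sum_congr rfl fun r _ => mul_comm _ _

theorem metricMatrix_mulVec_inl (hh : h.PosDef) (X : CIdx (n - k) k → ℂ) (q : Fin (n - k) × Fin k) :
    (metricMatrix h c Z *ᵥ X) (Sum.inl q) =
      ((c.horGram Z h)ᵀ * bar X * (c.gramInv Z h)ᵀ) q.1 q.2 := by
  rw [mul_mul_apply_eq_sum, Matrix.mulVec, dotProduct, Fintype.sum_sum_type]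
  simp only [metricMatrix_inl_inl c hh, metricMatrix_inl_inr c hh, zero_mul,
    Finset.sum_const_zero, zero_add]
  exact Finset.sum_congr rfl fun r _ => mul_comm _ _

/-- The metric is nondegenerate. -/
theorem isUnit_metricMatrix (hh : h.PosDef) : IsUnit (metricMatrix h c Z) := by
  have hK := c.isUnit_horGram (Z := Z) hh
  have hD : IsUnit (c.gramInv Z h) := by
    rw [AffineChart.gramInv, Matrix.isUnit_nonsing_inv_iff, Matrix.isUnit_iff_isUnit_det]
    exact c.isUnit_det_gram_sect hh
  have key : ∀ (K : Matrix (Fin (n - k)) (Fin (n - k)) ℂ) (D : Matrix (Fin k) (Fin k) ℂ)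
      (V : Matrix (Fin (n - k)) (Fin k) ℂ), IsUnit K → IsUnit D → K * V * D = 0 → V = 0 := by
    intro K D V hK hD h0
    have h1 := congrArg (fun W => K⁻¹ * W * D⁻¹) h0
    simp only [Matrix.mul_zero, Matrix.zero_mul] at h1
    rwa [Matrix.mul_assoc K, ← Matrix.mul_assoc K⁻¹, Matrix.nonsing_inv_mul _
      ((Matrix.isUnit_iff_isUnit_det _).1 hK), Matrix.one_mul, Matrix.mul_assoc,
      Matrix.mul_nonsing_inv _ ((Matrix.isUnit_iff_isUnit_det _).1 hD), Matrix.mul_one] at h1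
  rw [← Matrix.mulVec_injective_iff_isUnit]
  refine (injective_iff_map_eq_zero (metricMatrix h c Z).mulVecLin).2 fun X hX => ?_
  rw [Matrix.mulVecLin_apply] at hX
  have h1 : hol X = 0 := key _ _ _ hK hD (Matrix.ext fun i j => by
    rw [← metricMatrix_mulVec_inr c hh X (i, j), hX]; rfl)
  have h2 : bar X = 0 := key _ _ _ ((Matrix.isUnit_transpose _).2 hK)
    ((Matrix.isUnit_transpose _).2 hD) (Matrix.ext fun i j => by
    rw [← metricMatrix_mulVec_inl c hh X (i, j), hX]; rfl)
  ext (q | q)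
  · exact congrFun (congrFun h1 q.1) q.2
  · exact congrFun (congrFun h2 q.1) q.2

end LeviCivita

section Christoffel

variable {n k : ℕ} {h : Matrix (Fin n) (Fin n) ℂ} (c : AffineChart n k)
  {Z : Matrix (Fin (n - k)) (Fin k) ℂ}

/-- The holomorphic derivatives of the two factors of the metric along a holomorphic family of
affine coordinates are `∂Δ⁻¹ = -L E Δ⁻¹` and `∂K = -K E L` with `L = tangential`. -/
theorem AffineChart.hasMatrixWirtinger_metric (hh : h.PosDef)
    {F : ℂ → Matrix (Fin (n - k)) (Fin k) ℂ} {E : Matrix (Fin (n - k)) (Fin k) ℂ} {x : ℂ}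
    (hF : HasMatrixWirtinger F E 0 x) :
    (∃ B, HasMatrixWirtinger (fun y => c.gramInv (F y) h)
      (-(c.tangential (F x) h * E * c.gramInv (F x) h)) B x) ∧
    ∃ B, HasMatrixWirtinger (fun y => c.horGram (F y) h)
      (-(c.horGram (F x) h * E * c.tangential (F x) h)) B x := by
  have hs : HasMatrixWirtinger (fun y => c.sect (F y)) (c.Q * E) 0 x := by
    have := (HasMatrixWirtinger.const (x := x) c.P).add (hF.const_mul c.Q)
    rw [zero_add, Matrix.mul_zero, zero_add] at this
    exact this
  have hD := ((hs.conjTranspose.mul_const h).mul hs).inv (c.isUnit_det_gram_sect hh)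
  have hO := (((HasMatrixWirtinger.const (x := x) (1 : Matrix (Fin n) (Fin n) ℂ)).sub
    (((hs.mul hD).mul hs.conjTranspose).mul_const h)).const_mul (c.Qᴴ * h)).mul_const c.Q
  constructor
  · refine ⟨_, hD.congr_left ?_⟩
    simp only [AffineChart.tangential, AffineChart.gramInv, Matrix.conjTranspose_zero,
      Matrix.zero_mul, zero_add, Matrix.mul_assoc]
  · refine ⟨_, hO.congr_left ?_⟩
    simp only [AffineChart.horGram, AffineChart.tangential, AffineChart.gramInv, orthProj,
      Matrix.conjTranspose_zero, Matrix.zero_mul, Matrix.mul_zero, zero_add, add_zero,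
      Matrix.mul_assoc, Matrix.mul_sub, Matrix.sub_mul, Matrix.mul_add, Matrix.add_mul,
      Matrix.mul_neg, Matrix.neg_mul, zero_sub, Matrix.one_mul]
    abel

/-- The derivative of the component `g(∂/∂Z̄^q, ∂/∂Z^r)` along `∂/∂Z^b`. -/
noncomputable def metricDeriv (h : Matrix (Fin n) (Fin n) ℂ) (Z : Matrix (Fin (n - k)) (Fin k) ℂ)
    (q r b : Fin (n - k) × Fin k) : ℂ :=
  -(c.horGram Z h q.1 b.1 * c.tangential Z h b.2 r.1 * c.gramInv Z h r.2 q.2 +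
    c.horGram Z h q.1 r.1 * (c.tangential Z h r.2 b.1 * c.gramInv Z h b.2 q.2))

/-- The metric is Kähler: the derivatives of its components are symmetric in the holomorphic
indices. -/
theorem metricDeriv_comm (q r b : Fin (n - k) × Fin k) :
    metricDeriv c h Z q r b = metricDeriv c h Z q b r := by
  simp only [metricDeriv]
  ring

theorem hasWirtinger_metricMatrix (hh : h.PosDef) (q r b : Fin (n - k) × Fin k) :
    HasWirtinger (fun ζ => metricMatrix h c (Z + ζ • Matrix.single b.1 b.2 (1 : ℂ)) (Sum.inr q)
      (Sum.inl r)) (metricDeriv c h Z q r b) (star (metricDeriv c h Z r q b)) 0 := by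
  have key : ∀ q r : Fin (n - k) × Fin k, ∃ b', HasWirtinger
      (fun ζ => metricMatrix h c (Z + ζ • Matrix.single b.1 b.2 (1 : ℂ)) (Sum.inr q)
        (Sum.inl r)) (metricDeriv c h Z q r b) b' 0 := by
    intro q r
    obtain ⟨⟨B, hD⟩, ⟨B', hK⟩⟩ := c.hasMatrixWirtinger_metric hh
      (HasMatrixWirtinger.slice (x := 0) Z (Matrix.single b.1 b.2 (1 : ℂ)))
    have h1 := ((hK q.1 r.1).mul (hD r.2 q.2)).congr
      (Filter.Eventually.of_forall fun ζ => metricMatrix_inr_inl c hh q r)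
    rw [Matrix.neg_apply, Matrix.neg_apply, mul_single_mul_apply, mul_single_mul_apply,
      zero_smul, add_zero] at h1
    refine ⟨_, h1.congr_left ?_⟩
    simp only [metricDeriv, zero_smul, add_zero]
    ring
  -- the matrix of the metric is hermitian
  have hherm : ∀ Z', metricMatrix h c Z' (Sum.inr q) (Sum.inl r) =
      star (metricMatrix h c Z' (Sum.inr r) (Sum.inl q)) := by
    intro Z'
    rw [metricMatrix_inr_inl c hh, metricMatrix_inr_inl c hh, star_mul',
      ← Matrix.conjTranspose_apply, ← Matrix.conjTranspose_apply, c.conjTranspose_horGram hh,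
      c.conjTranspose_gramInv hh]
  obtain ⟨b₁, h1⟩ := key q r
  obtain ⟨b₂, h2⟩ := key r q
  have h3 := h2.star.congr (Filter.Eventually.of_forall fun ζ => hherm _)
  exact (h1.unique h3).2 ▸ h1

theorem coordDeriv_inr_inl (hh : h.PosDef) (q r b : Fin (n - k) × Fin k) :
    coordDeriv (fun Z' => metricMatrix h c Z' (Sum.inr q) (Sum.inl r)) Z (Sum.inl b) =
        metricDeriv c h Z q r b ∧
      coordDeriv (fun Z' => metricMatrix h c Z' (Sum.inr q) (Sum.inl r)) Z (Sum.inr b) =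
        star (metricDeriv c h Z r q b) :=
  ⟨coordDeriv_inl_eq (hasWirtinger_metricMatrix c hh q r b),
    coordDeriv_inr_eq (hasWirtinger_metricMatrix c hh q r b)⟩

theorem coordDeriv_zero {r s : ℕ} (Z : Matrix (Fin r) (Fin s) ℂ) (A : CIdx r s) :
    coordDeriv (fun _ => 0) Z A = 0 := by
  rcases A with q | q
  · exact coordDeriv_inl_eq (HasWirtinger.const 0)
  · exact coordDeriv_inr_eq (HasWirtinger.const 0)

theorem metricMatrix_symm (hh : h.PosDef) (q r : Fin (n - k) × Fin k) :
    metricMatrix h c Z (Sum.inl q) (Sum.inr r) = metricMatrix h c Z (Sum.inr r) (Sum.inl q) := by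
  rw [metricMatrix_inl_inr c hh, metricMatrix_inr_inl c hh]

/-- The Christoffel symbols of pure type, given by
`∇_X Y = ∂_X Y - (X Δ⁻¹ s† h Q Y + Y Δ⁻¹ s† h Q X)`. -/
theorem christoffel_inl_inl (hh : h.PosDef) (A : CIdx (n - k) k) (b d : Fin (n - k) × Fin k) :
    christoffel h c Z A (Sum.inl b) (Sum.inl d) = ofHol _ _
      (-(Matrix.single b.1 b.2 (1 : ℂ) * c.tangential Z h *
      Matrix.single d.1 d.2 (1 : ℂ) +
        Matrix.single d.1 d.2 (1 : ℂ) * c.tangential Z h * Matrix.single b.1 b.2 (1 : ℂ))) A := by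
  set v := ofHol _ _ (-(Matrix.single b.1 b.2 (1 : ℂ) * c.tangential Z h *
      Matrix.single d.1 d.2 (1 : ℂ) +
    Matrix.single d.1 d.2 (1 : ℂ) * c.tangential Z h * Matrix.single b.1 b.2 (1 : ℂ))) with hv
  have hu : IsUnit (metricMatrix h c Z).det :=
    (Matrix.isUnit_iff_isUnit_det _).1 (isUnit_metricMatrix c hh)
  have h1 : v = (metricMatrix h c Z)⁻¹ *ᵥ (metricMatrix h c Z *ᵥ v) := by
    rw [Matrix.mulVec_mulVec, Matrix.nonsing_inv_mul _ hu, Matrix.one_mulVec]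
  rw [h1, christoffel, Matrix.mulVec, dotProduct, Finset.mul_sum]
  refine Finset.sum_congr rfl fun F _ => ?_
  rw [mul_left_comm]
  congr 1
  simp only [metricMatrix_inl_inl c hh, coordDeriv_zero, sub_zero]
  rcases F with f | f
  · rw [metricMatrix_mulVec_inl c hh]
    have hb : bar v = 0 := rfl
    simp [metricMatrix_inl_inl c hh, coordDeriv_zero, hb]
  · rw [metricMatrix_mulVec_inr c hh, (coordDeriv_inr_inl c hh f d b).1,
      (coordDeriv_inr_inl c hh f b d).1, metricDeriv_comm c f b d]
    have hv' : hol v = -(Matrix.single b.1 b.2 (1 : ℂ) * c.tangential Z h *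
      Matrix.single d.1 d.2 (1 : ℂ) +
      Matrix.single d.1 d.2 (1 : ℂ) * c.tangential Z h * Matrix.single b.1 b.2 (1 : ℂ)) := rfl
    have key : ∀ b d : Fin (n - k) × Fin k, (c.horGram Z h * (Matrix.single b.1 b.2 (1 : ℂ) *
        c.tangential Z h * Matrix.single d.1 d.2 (1 : ℂ)) * c.gramInv Z h) f.1 f.2 =
        c.horGram Z h f.1 b.1 * c.tangential Z h b.2 d.1 * c.gramInv Z h d.2 f.2 := by
      intro b d
      rw [← Matrix.mul_assoc, ← Matrix.mul_assoc, mul_single_mul_apply, mul_single_mul_apply]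
    rw [hv', Matrix.mul_neg, Matrix.neg_mul, Matrix.mul_add, Matrix.add_mul, Matrix.neg_apply,
      Matrix.add_apply, key, key, metricDeriv]
    ring

/-- The Christoffel symbols with one lower index of each type vanish, as for every Kähler
metric. -/
theorem christoffel_inr_inl (hh : h.PosDef) (A : CIdx (n - k) k) (b d : Fin (n - k) × Fin k) :
    christoffel h c Z A (Sum.inr b) (Sum.inl d) = 0 := by
  rw [christoffel, mul_eq_zero]
  refine Or.inr (Finset.sum_eq_zero fun F _ => mul_eq_zero_of_right _ ?_)
  rcases F with f | f
  · simp only [metricMatrix_inl_inl c hh, coordDeriv_zero, metricMatrix_symm c hh,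
      (coordDeriv_inr_inl c hh _ _ _).1]
    rw [metricDeriv_comm c b f d]
    ring
  · simp only [metricMatrix_inr_inr c hh, coordDeriv_zero, (coordDeriv_inr_inl c hh _ _ _).2]
    rw [metricDeriv_comm c d f b]
    ring

theorem sum_sum_mul_single {R S R' S' : Type*} [Fintype R] [Fintype S] [Fintype R'] [Fintype S']
    [DecidableEq R] [DecidableEq S] [DecidableEq R'] [DecidableEq S'] (X : Matrix R S ℂ)
    (L : Matrix S R' ℂ) (Y : Matrix R' S' ℂ) :
    ∑ b : R × S, ∑ d : R' × S', (X b.1 b.2 * Y d.1 d.2) •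
      (Matrix.single b.1 b.2 (1 : ℂ) * L * Matrix.single d.1 d.2 (1 : ℂ)) = X * L * Y := by
  conv_rhs => rw [Matrix.matrix_eq_sum_single X, Matrix.matrix_eq_sum_single Y,
    ← Fintype.sum_prod_type', ← Fintype.sum_prod_type']
  simp only [Matrix.sum_mul, Matrix.mul_sum]
  rw [Finset.sum_comm]
  refine Finset.sum_congr rfl fun d _ => Finset.sum_congr rfl fun b _ => ?_
  have h1 : Matrix.single b.1 b.2 (X b.1 b.2) = X b.1 b.2 • Matrix.single b.1 b.2 (1 : ℂ) := by
    rw [Matrix.smul_single, smul_eq_mul, mul_one]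
  have h2 : Matrix.single d.1 d.2 (Y d.1 d.2) = Y d.1 d.2 • Matrix.single d.1 d.2 (1 : ℂ) := by
    rw [Matrix.smul_single, smul_eq_mul, mul_one]
  rw [h1, h2, Matrix.smul_mul, Matrix.smul_mul, Matrix.mul_smul, smul_smul]

/-- The covariant derivative of a field of type `(1, 0)` on a holomorphic curve, where `X'` is the
derivative of its components and `Z'` that of the affine coordinates of the curve. -/
theorem covDeriv_eq {M : Type*} (hh : h.PosDef) {ψ : M → Gr n k} {dd : (M → ℂ) → M → ℂ}
    {X : M → CIdx (n - k) k → ℂ} {p : M} {Z' X' V : Matrix (Fin (n - k)) (Fin k) ℂ}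
    (hX : X p = ofHol _ _ V) (hdX : (fun A => dd (fun q => X q A) p) = ofHol _ _ X')
    (hZ : ∀ i j, dd (fun q => c.coord (ψ q) i j) p = Z' i j) :
    covDeriv h c ψ dd X p = ofHol _ _ (X' - (Z' * c.tangential (c.coord (ψ p)) h * V +
      V * c.tangential (c.coord (ψ p)) h * Z')) := by
  set L := c.tangential (c.coord (ψ p)) h with hL
  have h1 : Z' * L * V + V * L * Z' = ∑ b : Fin (n - k) × Fin k, ∑ d : Fin (n - k) × Fin k,
      (Z' b.1 b.2 * V d.1 d.2) • (Matrix.single b.1 b.2 (1 : ℂ) * L *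
        Matrix.single d.1 d.2 (1 : ℂ) +
        Matrix.single d.1 d.2 (1 : ℂ) * L * Matrix.single b.1 b.2 (1 : ℂ)) := by
    simp only [smul_add, Finset.sum_add_distrib]
    rw [sum_sum_mul_single, Finset.sum_comm]
    congr 1
    simp only [mul_comm (Z' _ _)]
    rw [sum_sum_mul_single]
  rw [h1, map_sub, ← hdX]
  funext A
  rw [covDeriv, Pi.sub_apply, sub_eq_add_neg]
  congr 1
  rw [Fintype.sum_sum_type, Finset.sum_eq_zero (s := Finset.univ)
    (f := fun b => ∑ D, _ * dd (fun q => coordFn (c.coord (ψ q)) (Sum.inr b)) p * X p D), add_zero]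
  · simp only [map_sum, map_smul, Finset.sum_apply, Pi.smul_apply, smul_eq_mul,
      ← Finset.sum_neg_distrib]
    refine Finset.sum_congr rfl fun b _ => ?_
    rw [Fintype.sum_sum_type, hX]
    simp only [ofHol_inr, mul_zero, Finset.sum_const_zero, add_zero]
    refine Finset.sum_congr rfl fun d _ => ?_
    rw [christoffel_inl_inl c hh, map_neg, Pi.neg_apply, ofHol_inl]
    change -_ * dd (fun q => c.coord (ψ q) b.1 b.2) p * _ = _
    rw [hZ]
    ring
  · intro b _
    rw [Fintype.sum_sum_type, hX]
    simp [christoffel_inr_inl c hh]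

end Christoffel

/-! ### The connection coefficients of the moving frame -/

section Connection

/-- `Q T` is the projection along `w` onto the range of `Q`, so that `L T = Δ⁻¹ s† h Q T` is the
orthogonal projection to the span of `w`, less `A`, in the basis `s = w (A w)⁻¹`. -/
theorem AffineChart.tangential_mul_diffLeft {n k : ℕ} {h : Matrix (Fin n) (Fin n) ℂ}
    (c : AffineChart n k) {w : Matrix (Fin n) (Fin k) ℂ}
    (hu : IsUnit (c.A * w).det) (hw : IsUnit (wᴴ * h * w).det) :
    c.tangential (c.coordFun w) h * c.diffLeft w =
      c.A * w * (wᴴ * h * w)⁻¹ * wᴴ * h - c.A := by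
  have hs := c.sect_coordFun w ((Matrix.isUnit_iff_isUnit_det _).2 hu)
  have hG : c.gramInv (c.coordFun w) h = c.A * w * (wᴴ * h * w)⁻¹ * (c.A * w)ᴴ := by
    rw [gramInv, hs]
    apply Matrix.inv_eq_left_inv
    have e1 : (c.A * w)ᴴ * (w * (c.A * w)⁻¹)ᴴ = wᴴ := by
      rw [← Matrix.conjTranspose_mul, Matrix.mul_assoc, Matrix.nonsing_inv_mul _ hu,
        Matrix.mul_one]
    calc _ = c.A * w * (wᴴ * h * w)⁻¹ * ((c.A * w)ᴴ * (w * (c.A * w)⁻¹)ᴴ) * h *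
          (w * (c.A * w)⁻¹) := by simp only [Matrix.mul_assoc]
      _ = c.A * w * ((wᴴ * h * w)⁻¹ * (wᴴ * h * w)) * (c.A * w)⁻¹ := by
          rw [e1]; simp only [Matrix.mul_assoc]
      _ = 1 := by rw [Matrix.nonsing_inv_mul _ hw, Matrix.mul_one, Matrix.mul_nonsing_inv _ hu]
  have e1 : (c.A * w)ᴴ * (w * (c.A * w)⁻¹)ᴴ = wᴴ := by
    rw [← Matrix.conjTranspose_mul, Matrix.mul_assoc, Matrix.nonsing_inv_mul _ hu,
      Matrix.mul_one]
  have e2 : c.tangential (c.coordFun w) h = c.A * w * (wᴴ * h * w)⁻¹ * wᴴ * h * c.Q := by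
    rw [tangential, hG, hs, Matrix.mul_assoc _ (c.A * w)ᴴ, e1]
  rw [e2, Matrix.mul_assoc, c.Q_mul_diffLeft hu, Matrix.mul_sub, Matrix.mul_one]
  congr 1
  calc _ = c.A * w * ((wᴴ * h * w)⁻¹ * (wᴴ * h * w)) * (c.A * w)⁻¹ * c.A := by
        simp only [Matrix.mul_assoc]
    _ = c.A := by
        rw [Matrix.nonsing_inv_mul _ hw, Matrix.mul_one, Matrix.mul_nonsing_inv _ hu,
          Matrix.one_mul]

variable {M : Type*} [TopologicalSpace M] {n t : ℕ} {κ : Fin (t + 1) → ℕ}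
  {h : Matrix (Fin n) (Fin n) ℂ} {z : OpenPartialHomeomorph M ℂ} {ψ : M → Gr n (κ 0)}
  {ξ : (a : Fin (t + 1)) → M → Matrix (Fin n) (Fin (κ a)) ℂ}
  {B : (b a : Fin (t + 1)) → M → Matrix (Fin (κ b)) (Fin (κ a)) ℂ} {p : M}

theorem IsHolomorphicLift.coord_eq (hlift : IsHolomorphicLift z ψ (ξ 0)) (hp : p ∈ z.source)
    (c : AffineChart n (κ 0)) : c.coord (ψ p) = c.coordFun (ξ 0 p) := by
  obtain ⟨hr, hq⟩ := hlift.2 p hp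
  rw [← hq, c.coord_proj]

theorem IsHolomorphicLift.isUnit_det (hlift : IsHolomorphicLift z ψ (ξ 0)) (hp : p ∈ z.source)
    {c : AffineChart n (κ 0)} (hc : ψ p ∈ c.domain) : IsUnit (c.A * ξ 0 p).det := by
  obtain ⟨hr, hq⟩ := hlift.2 p hp
  rw [← hq, c.proj_mem_domain] at hc
  exact (Matrix.isUnit_iff_isUnit_det _).1 hc

omit [TopologicalSpace M] in
/-- The coefficients of the vector `horFrame W (A ξ_0)⁻¹` in the moving frame are the entries of
`W`. -/
theorem sum_smul_movingE_eq_iff (hh : h.PosDef)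
    (hξ : LinearIndependent ℂ fun (x : BlockIdx κ) (i : Fin n) => ξ x.1 p i x.2)
    (hcard : Fintype.card (BlockIdx κ) = n) (c : AffineChart n (κ 0))
    (hu : IsUnit (c.A * ξ 0 p).det) (W W' : Matrix (HorIdx κ) (Fin (κ 0)) ℂ) :
    ofHol _ _ (horFrame h ξ c p * W * (c.A * ξ 0 p)⁻¹) =
      ∑ ν, ∑ β, W' ν β • movingE h ξ c ν β p ↔ W' = W := by
  obtain ⟨S, hS, -⟩ := exists_inverse_horFrame hh hξ hcard c hu
  rw [sum_smul_movingE c hu, (ofHol_injective _ _).eq_iff]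
  refine ⟨fun h1 => ?_, fun h1 => by rw [h1]⟩
  have h2 := congrArg (fun V => S * (V * (c.A * ξ 0 p))) h1
  simp only [Matrix.mul_assoc, Matrix.nonsing_inv_mul _ hu, Matrix.mul_one] at h2
  rwa [← Matrix.mul_assoc, ← Matrix.mul_assoc, hS, Matrix.one_mul, Matrix.one_mul, eq_comm] at h2

omit [TopologicalSpace M] in
/-- The vectors `E^α_μ` form a basis of the vectors of type `(1, 0)`. -/
theorem movingE_basis (hh : h.PosDef)
    (hξ : LinearIndependent ℂ fun (x : BlockIdx κ) (i : Fin n) => ξ x.1 p i x.2)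
    (hcard : Fintype.card (BlockIdx κ) = n) (c : AffineChart n (κ 0))
    (hu : IsUnit (c.A * ξ 0 p).det) :
    LinearIndependent ℂ (fun x : HorIdx κ × Fin (κ 0) => movingE h ξ c x.1 x.2 p) ∧
      Submodule.span ℂ (Set.range fun x : HorIdx κ × Fin (κ 0) => movingE h ξ c x.1 x.2 p) =
        holVectors (n - κ 0) (κ 0) := by
  constructor
  · rw [Fintype.linearIndependent_iff]
    intro g hg x
    have h1 := sum_smul_movingE_eq_iff hh hξ hcard c hu 0 (Matrix.of fun ν β => g (ν, β))
    rw [Fintype.sum_prod_type] at hg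
    rw [Matrix.mul_zero, Matrix.zero_mul, map_zero] at h1
    exact congrFun (congrFun (h1.1 hg.symm) x.1) x.2
  · apply le_antisymm
    · rw [Submodule.span_le]
      rintro _ ⟨x, rfl⟩
      simp only [movingE_eq c hu, SetLike.mem_coe, ← range_ofHol]
      exact LinearMap.mem_range_self _ _
    · rw [← range_ofHol]
      rintro _ ⟨V, rfl⟩
      obtain ⟨S, -, hS⟩ := exists_inverse_horFrame hh hξ hcard c hu
      have h1 : V = horFrame h ξ c p * (S * V * (c.A * ξ 0 p)) * (c.A * ξ 0 p)⁻¹ := by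
        rw [Matrix.mul_assoc, Matrix.mul_assoc _ (c.A * ξ 0 p), Matrix.mul_nonsing_inv _ hu,
          Matrix.mul_one, ← Matrix.mul_assoc, hS, Matrix.one_mul]
      rw [h1, ← sum_smul_movingE c hu]
      exact Submodule.sum_mem _ fun ν _ => Submodule.sum_mem _ fun β _ =>
        Submodule.smul_mem _ _ (Submodule.subset_span ⟨(ν, β), rfl⟩)

/-- `β_0⁻¹ ∂_- β_0 = (ξ_0† h ξ_0)⁻¹ ξ_0† h ∂_- ξ_0`, since `ξ_0` is holomorphic. -/
theorem logDerivBeta_zero (hh : h.PosDef) (hξ : IsOsculatingSequence z ξ B) (hp : p ∈ z.source) :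
    logDerivBeta h ξ z 0 p = ((ξ 0 p)ᴴ * h * ξ 0 p)⁻¹ *
      ((ξ 0 p)ᴴ * h * mapMat (dMinus z) (ξ 0) p) := by
  have h1 := ((hξ.holomorphic 0).hasMatrixWirtinger hp).congr
    (Filter.Eventually.of_forall fun y => phi_zero (h := h) (ξ := ξ) (p := z.symm y))
  have h2 := logDerivBeta_eq hh hξ hp 0 h1
  rwa [beta, phi_zero] at h2

/-- The block of a matrix of coefficients that belongs to the horizontal columns of the frame. -/
def horBlock (L : Matrix (BlockIdx κ) (BlockIdx κ) ℂ) : Matrix (HorIdx κ) (HorIdx κ) ℂ :=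
  L.submatrix Subtype.val Subtype.val

omit [TopologicalSpace M] in
theorem diffLeft_mul_frame_mul_horBlock (c : AffineChart n (κ 0))
    (hu : IsUnit (c.A * ξ 0 p).det) (L : Matrix (BlockIdx κ) (BlockIdx κ) ℂ) :
    c.diffLeft (ξ 0 p) * (frame h ξ p * L).submatrix id Subtype.val =
      horFrame h ξ c p * horBlock L :=
  diffLeft_mul_frame_mul c hu (L.submatrix id Subtype.val : Matrix (BlockIdx κ) (HorIdx κ) ℂ)

omit [TopologicalSpace M] in
theorem conjTranspose_mul_horizontal (hh : h.PosDef)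
    (hξ : LinearIndependent ℂ fun (x : BlockIdx κ) (i : Fin n) => ξ x.1 p i x.2) :
    (ξ 0 p)ᴴ * h * ((frame h ξ p).submatrix id Subtype.val : Matrix _ (HorIdx κ) ℂ) = 0 := by
  ext j ν
  have h1 := congrFun (congrFun (phi_orthogonal hξ hh ν.2.symm) j) ν.1.2
  rwa [phi_zero] at h1

/-- The covariant derivatives of the moving frame. With `T = C - Z A` and `a = A ξ_0`, the field
`E^α_μ = T f_μ e_α a⁻¹`, where `e_α` is a row vector, satisfies
`∇_- E^α_μ = T (∂_- f_μ e_α - f_μ e_α β_0⁻¹ ∂_- β_0) a⁻¹` and `∇_+ E^α_μ = T ∂_+ f_μ e_α a⁻¹`. The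
derivatives of `f_μ` are replaced by the Frenet equations, in which only the horizontal columns
survive the multiplication by `T`. -/
theorem covDeriv_movingE (hh : h.PosDef) (hlift : IsHolomorphicLift z ψ (ξ 0))
    (hξ : IsOsculatingSequence z ξ B) (hp : p ∈ z.source) {c : AffineChart n (κ 0)}
    (hc : ψ p ∈ c.domain) (μ : HorIdx κ) (α : Fin (κ 0)) :
    covDeriv h c ψ (dMinus z) (movingE h ξ c μ α) p = ofHol _ _ (horFrame h ξ c p *
      (horBlock (lamMinus h ξ z B p) * Matrix.single μ α (1 : ℂ) -
        Matrix.single μ α (1 : ℂ) * logDerivBeta h ξ z 0 p) * (c.A * ξ 0 p)⁻¹) ∧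
    covDeriv h c ψ (dPlus z) (movingE h ξ c μ α) p = ofHol _ _ (horFrame h ξ c p *
      (horBlock (lamPlus h ξ B p) * Matrix.single μ α (1 : ℂ)) *
        (c.A * ξ 0 p)⁻¹) := by
  have hu := hlift.isUnit_det hp hc
  have hw : IsUnit ((ξ 0 p)ᴴ * h * ξ 0 p).det := by
    have := isUnit_det_beta (hξ.linearIndependent p hp) hh 0
    rwa [beta, phi_zero] at this
  have hξ0 := (hξ.holomorphic 0).hasMatrixWirtinger hp
  set ξ' := mapMat (dMinus z) (ξ 0) p with hξ'
  set a := c.A * ξ 0 p with ha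
  set T := c.diffLeft (ξ 0 p) with hT
  set E : Matrix (HorIdx κ) (Fin (κ 0)) ℂ := Matrix.single μ α (1 : ℂ) with hE
  set Z' := T * ξ' * a⁻¹ with hZ'
  have hs := eventually_symm_mem_source hp
  -- the coordinates of the curve
  have hcoord := c.hasMatrixWirtinger_coordFun hξ0 (by rwa [z.left_inv hp])
  simp only [z.left_inv hp, Matrix.mul_zero, Matrix.zero_mul] at hcoord
  have hZ := hcoord.congr (hs.mono fun y hy => hlift.coord_eq hy c)
  -- the components of the moving frame
  have hF : HasMatrixWirtinger
      (fun y => ((frame h ξ (z.symm y)).submatrix id Subtype.val : Matrix _ (HorIdx κ) ℂ))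
      ((frame h ξ p * lamMinus h ξ z B p).submatrix id Subtype.val)
      ((frame h ξ p * lamPlus h ξ B p).submatrix id Subtype.val) (z p) :=
    fun i ν => hasMatrixWirtinger_frame hh hξ hp i ν.1
  set F : Matrix (Fin n) (HorIdx κ) ℂ := (frame h ξ p).submatrix id Subtype.val with hFdef
  let Xm : Matrix (Fin (n - κ 0)) (Fin (κ 0)) ℂ :=
    ((0 - Z' * c.A) * F + horFrame h ξ c p * horBlock (lamMinus h ξ z B p)) * E * a⁻¹ +
      horFrame h ξ c p * E * -(a⁻¹ * (c.A * ξ') * a⁻¹)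
  let Xp : Matrix (Fin (n - κ 0)) (Fin (κ 0)) ℂ :=
    ((0 - (0 : Matrix (Fin (n - κ 0)) (Fin (κ 0)) ℂ) * c.A) * F +
      horFrame h ξ c p * horBlock (lamPlus h ξ B p)) * E * a⁻¹ +
      horFrame h ξ c p * E * -(a⁻¹ * (c.A * (0 : Matrix (Fin n) (Fin (κ 0)) ℂ)) * a⁻¹)
  have hV : HasMatrixWirtinger
      (fun y => horFrame h ξ c (z.symm y) * E * (c.A * ξ 0 (z.symm y))⁻¹) Xm Xp (z p) := by
    have h1 := ((((HasMatrixWirtinger.const c.C).sub (hcoord.mul_const c.A)).mul hF).mul_const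
      E).mul ((hξ0.const_mul c.A).inv (by rwa [z.left_inv hp]))
    simp only [z.left_inv hp] at h1
    simp only [Xm, Xp]
    rw [← diffLeft_mul_frame_mul_horBlock c hu, ← diffLeft_mul_frame_mul_horBlock c hu]
    exact h1
  have hXV : ∀ᶠ y in nhds (z p), movingE h ξ c μ α (z.symm y) =
      ofHol _ _ (horFrame h ξ c (z.symm y) * E * (c.A * ξ 0 (z.symm y))⁻¹) := by
    have h1 := (hξ0.const_mul c.A).eventually_isUnit (by rwa [z.left_inv hp])
    exact h1.mono fun y hy => movingE_eq c hy μ α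
  have hXl : ∀ q, HasWirtinger (fun y => movingE h ξ c μ α (z.symm y) (Sum.inl q))
      (Xm q.1 q.2) (Xp q.1 q.2) (z p) :=
    fun q => (hV q.1 q.2).congr (hXV.mono fun y hy => congrFun hy (Sum.inl q))
  have hXr : ∀ q, HasWirtinger (fun y => movingE h ξ c μ α (z.symm y) (Sum.inr q)) 0 0 (z p) :=
    fun q => (HasWirtinger.const 0).congr (hXV.mono fun y hy => congrFun hy (Sum.inr q))
  have hperp : (ξ 0 p)ᴴ * h * F = 0 := conjTranspose_mul_horizontal hh (hξ.linearIndependent p hp)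
  have hLT := c.tangential_mul_diffLeft (h := h) hu hw
  rw [← hlift.coord_eq hp c, ← ha, ← hT] at hLT
  constructor
  · rw [covDeriv_eq c hh (movingE_eq c hu μ α) (Z' := Z') (X' := Xm) (funext fun A => by
      rcases A with q | q
      · exact (hXl q).dHol_eq
      · exact (hXr q).dHol_eq) fun i j => (hZ i j).dHol_eq]
    congr 1
    set L := c.tangential (c.coord (ψ p)) h
    -- `Z' L E = -Z' A F e_α a⁻¹` cancels the derivative of `T`
    have h1 : Z' * L * (horFrame h ξ c p * E * a⁻¹) = -(Z' * c.A * F * E * a⁻¹) := by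
      calc _ = Z' * (L * T) * F * E * a⁻¹ := by
            simp only [horFrame, Matrix.mul_assoc, hT, hFdef]
        _ = Z' * (a * ((ξ 0 p)ᴴ * h * ξ 0 p)⁻¹ * ((ξ 0 p)ᴴ * h * F) - c.A * F) * E * a⁻¹ := by
            rw [hLT, Matrix.mul_assoc Z', Matrix.sub_mul]
            simp only [Matrix.mul_assoc]
        _ = _ := by
            rw [hperp, Matrix.mul_zero, zero_sub]
            simp only [Matrix.mul_neg, Matrix.neg_mul, Matrix.mul_assoc]
    have h2 : horFrame h ξ c p * E * a⁻¹ * L * Z' =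
        horFrame h ξ c p * (E * logDerivBeta h ξ z 0 p) * a⁻¹ -
          horFrame h ξ c p * E * (a⁻¹ * (c.A * ξ') * a⁻¹) := by
      calc _ = horFrame h ξ c p * E * (a⁻¹ * (L * T)) * ξ' * a⁻¹ := by
            simp only [hZ', Matrix.mul_assoc]
        _ = horFrame h ξ c p * E * (((ξ 0 p)ᴴ * h * ξ 0 p)⁻¹ * (ξ 0 p)ᴴ * h - a⁻¹ * c.A) *
              ξ' * a⁻¹ := by
            rw [hLT, Matrix.mul_sub]
            simp only [← Matrix.mul_assoc]
            rw [Matrix.nonsing_inv_mul _ hu, Matrix.one_mul]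
        _ = _ := by
            rw [logDerivBeta_zero hh hξ hp]
            simp only [Matrix.mul_sub, Matrix.sub_mul, Matrix.mul_assoc, hξ']
    rw [h1, h2]
    simp only [Xm, Matrix.mul_sub, Matrix.sub_mul, Matrix.add_mul, Matrix.mul_neg,
      Matrix.mul_assoc, zero_sub, Matrix.neg_mul]
    abel
  · rw [covDeriv_eq c hh (movingE_eq c hu μ α) (Z' := 0) (X' := Xp) (funext fun A => by
      rcases A with q | q
      · exact (hXl q).dBar_eq
      · exact (hXr q).dBar_eq) fun i j => (hZ i j).dBar_eq]
    congr 1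
    simp [Xp, Matrix.mul_assoc]

end Connection

theorem mul_single_one_apply {l m r : Type*} [Fintype m] [DecidableEq m] [DecidableEq r]
    (L : Matrix l m ℂ) (μ : m) (α : r) (ν : l) (β : r) :
    (L * Matrix.single μ α (1 : ℂ)) ν β = if α = β then L ν μ else 0 := by
  rw [Matrix.mul_apply, Finset.sum_eq_single μ (fun i _ hi => by simp [Matrix.single, hi.symm])
    (by simp)]
  simp [Matrix.single]

theorem single_one_mul_apply {l m r : Type*} [Fintype m] [DecidableEq m] [DecidableEq l]
    (L : Matrix m r ℂ) (μ : l) (α : m) (ν : l) (β : r) :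
    (Matrix.single μ α (1 : ℂ) * L) ν β = L α β * if ν = μ then 1 else 0 := by
  rw [Matrix.mul_apply, Finset.sum_eq_single α (fun i _ hi => by simp [Matrix.single, hi.symm])
    (by simp)]
  simp [Matrix.single, eq_comm (a := ν)]

end FrenetGrassmann

theorem mainTheorem3 {M : Type*} [TopologicalSpace M] [ChartedSpace ℂ M] [IsManifold 𝓘(ℂ) 1 M]
    [ConnectedSpace M]
    {n t : ℕ} {κ : Fin (t + 1) → ℕ} (hn : κ 0 < n)
    (h : Matrix (Fin n) (Fin n) ℂ) (hh : h.PosDef)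
    (ψ : M → Gr n (κ 0))
    (hψ : MDifferentiable 𝓘(ℂ) 𝓘(ℂ, Fin (n - κ 0) → Fin (κ 0) → ℂ) ψ)
    (hfull : LinearlyFull ψ)
    (z : OpenPartialHomeomorph M ℂ) (hz : z ∈ IsManifold.maximalAtlas 𝓘(ℂ) 1 M)
    (ξ : (a : Fin (t + 1)) → M → Matrix (Fin n) (Fin (κ a)) ℂ)
    (hlift : IsHolomorphicLift z ψ (ξ 0))
    (B : (b a : Fin (t + 1)) → M → Matrix (Fin (κ b)) (Fin (κ a)) ℂ)
    (hξ : IsOsculatingSequence z ξ B) :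
    -- the Frenet equations
    (∀ p ∈ z.source,
      mapMat (dMinus z) (frame h ξ) p = frame h ξ p * lamMinus h ξ z B p ∧
      mapMat (dPlus z) (frame h ξ) p = frame h ξ p * lamPlus h ξ B p) ∧
    -- the moving frame and the connection coefficients, in every affine chart around `ψ p`
    ∀ p ∈ z.source, ∀ c : AffineChart n (κ 0), ψ p ∈ c.domain →
      LinearIndependent ℂ (fun x : HorIdx κ × Fin (κ 0) => movingE h ξ c x.1 x.2 p) ∧
      Submodule.span ℂ (Set.range fun x : HorIdx κ × Fin (κ 0) => movingE h ξ c x.1 x.2 p) =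
        holVectors (n - κ 0) (κ 0) ∧
      (∀ Λ : HorIdx κ → Fin (κ 0) → Fin (κ 0) → HorIdx κ → ℂ,
        (∀ μ α, covDeriv h c ψ (dMinus z) (movingE h ξ c μ α) p =
            ∑ ν, ∑ β, Λ ν α β μ • movingE h ξ c ν β p) ↔
        ∀ ν α β μ, Λ ν α β μ =
          (if α = β then lamMinus h ξ z B p ν.1 μ.1 else 0)
            - logDerivBeta h ξ z 0 p α β * (if ν = μ then 1 else 0)) ∧
      (∀ Λ : HorIdx κ → Fin (κ 0) → Fin (κ 0) → HorIdx κ → ℂ,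
        (∀ μ α, covDeriv h c ψ (dPlus z) (movingE h ξ c μ α) p =
            ∑ ν, ∑ β, Λ ν α β μ • movingE h ξ c ν β p) ↔
        ∀ ν α β μ, Λ ν α β μ = if α = β then lamPlus h ξ B p ν.1 μ.1 else 0) := by
  refine ⟨fun p hp => ⟨mapMat_dMinus_eq (hasMatrixWirtinger_frame hh hξ hp),
    mapMat_dPlus_eq (hasMatrixWirtinger_frame hh hξ hp)⟩, fun p hp c hc => ?_⟩
  have hcard := card_blockIdx_eq hψ hfull hlift hξ hp
  have hli := hξ.linearIndependent p hp
  have hu := hlift.isUnit_det hp hc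
  obtain ⟨hb1, hb2⟩ := movingE_basis hh hli hcard c hu
  refine ⟨hb1, hb2, fun Λ => ?_, fun Λ => ?_⟩
  · have key : ∀ μ α, covDeriv h c ψ (dMinus z) (movingE h ξ c μ α) p =
        ∑ ν, ∑ β, Λ ν α β μ • movingE h ξ c ν β p ↔ Matrix.of (fun ν β => Λ ν α β μ) =
          horBlock (lamMinus h ξ z B p) * Matrix.single μ α (1 : ℂ) -
            Matrix.single μ α (1 : ℂ) * logDerivBeta h ξ z 0 p := fun μ α => by
      rw [(covDeriv_movingE hh hlift hξ hp hc μ α).1]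
      exact sum_smul_movingE_eq_iff hh hli hcard c hu _ (Matrix.of fun ν β => Λ ν α β μ)
    simp only [key, ← Matrix.ext_iff, Matrix.of_apply, Matrix.sub_apply, mul_single_one_apply,
      single_one_mul_apply]
    exact ⟨fun H ν α β μ => H μ α ν β, fun H μ α ν β => H ν α β μ⟩
  · have key : ∀ μ α, covDeriv h c ψ (dPlus z) (movingE h ξ c μ α) p =
        ∑ ν, ∑ β, Λ ν α β μ • movingE h ξ c ν β p ↔ Matrix.of (fun ν β => Λ ν α β μ) =
          horBlock (lamPlus h ξ B p) * Matrix.single μ α (1 : ℂ) := fun μ α => by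
      rw [(covDeriv_movingE hh hlift hξ hp hc μ α).2]
      exact sum_smul_movingE_eq_iff hh hli hcard c hu _ (Matrix.of fun ν β => Λ ν α β μ)
    simp only [key, ← Matrix.ext_iff, Matrix.of_apply, mul_single_one_apply]
    exact ⟨fun H ν α β μ => H μ α ν β, fun H μ α ν β => H ν α β μ⟩
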